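/- **Definitions.** Let $f:[0,\infty)\to[0,\infty)$ be strictly increasing. - $f$ is *finite type at zero* if it is continuous and $\lim_{x\to0^+} f(x)/x^m$ exists and is positive and finite for some real $m>1$. - $f$ is *mildly infinite type at zero* if it is smooth on $[0,\infty)$, $f^{(l)}(0)=0$ for all $l\ge 0$, and there are $R>0$ with $f(R)<1$ and $\sigma>1$ such that $\Lambda_f(0)=0$, $\Lambda_f(x)=-1/\log f(x)$ $(0<x\le R)$ satisfies $2\Lambda_f(x)\le\Lambda_f(\sigma x)$ for all $x\in[0,R/\sigma]$. Write $z=(z',z_n)\in\mathbb C^{n-1}\times\mathbb C$. Group the $2(n-1)$ real coordinates of $z'$ (the real and imaginary parts of $z_1,\dots,z_{n-1}$), in any manner, into $k\ge1$ blocks $s^j\in\mathbb R^{n_j}$, $n_j\ge1$, $n_1+\dots+n_k=2(n-1)$. Let each $f_j$ be either finite type at zero or mildly infinite type at zero, let $F(z')=f_1(|s^1|)+\dots+f_k(|s^k|)$ be smooth on $\mathbb C^{n-1}$, and let $\delta>0$. A domain $D\subset\mathbb C^n$ with $0\in bD$ is an *extended generalized decoupled domain near $0$* (with these data) if $D\subset\{\operatorname{Re}z_n>0\}$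 and there is a neighbourhood $U$ of $0$ with $$D\cap U=\{z\in U:\operatorname{Re}z_n>F(z')\},\qquad D\cap U^c\subset\{z\in D:|z_n|>\delta\}.$$ Let $\kappa_D(z)=K_D(z,z)=\sup\{|f(z)|^2: f\in A^2(D),\ \|f\|_{L^2(D)}\le1\}$, where $K_D$ is the Bergman kernel, the reproducing kernel of the space $A^2(D)$ of square-integrable holomorphic functions on $D$. Let $H^2(D)$ be the space of holomorphic $f$ on $D$ with $$\|f\|^2_{H^2(D)}=\limsup_{\varepsilon\to0^+}\int_{bD_\varepsilon}|f|^2\,d\sigma<\infty,\qquad D_\varepsilon=\{z\in D:\operatorname{dist}(z,bD)>\varepsilon\},$$ with $\sigma$ the surface measure, and let $\mathcal S_D(z)=S_D(z,z)=\sup\{|f(z)|^2: f\in H^2(D),\ \|f\|_{H^2(D)}\le1\}$, where $S_D$ is the Szegő kernel, the reproducing kernel of $H^2(D)$: $f(z)=\int_{bD}f^\star(\xi)\,S_D(z,\xi)\,d\sigma(\xi)$ for $f\in H^2(D)$ with non-tangential boundary values $f^\star$. **Theorem.** Let $D\subset\mathbb C^n$ be a bounded domain with $C^2$-smooth boundary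 and $0\in bD$, and suppose that $D$ is an extended generalized decoupled domain near $0$ with the data above. Then there is a constant $C=C(\delta)>0$, which may also depend on $D$ and on the $f_j$ and their blocks but not on $z$, such that $$\kappa_D(z)\ge C\,(\operatorname{Re}z_n)^{-2}\prod_{j=1}^k\bigl[f_j^{-1}(\operatorname{Re}z_n)\bigr]^{-n_j},\qquad \mathcal S_D(z)\ge C\,(\operatorname{Re}z_n)^{-1}\prod_{j=1}^k\bigl[f_j^{-1}(\operatorname{Re}z_n)\bigr]^{-n_j}$$ for every $z\in D$ with $|z_n|<\delta/2$ for which $\operatorname{Re}z_n$ lies in the range of every $f_j$ (so that the right-hand sides are defined). -/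

import Mathlib

open MeasureTheory Set Filter Topology
open scoped ENNReal ContDiff

/-! ### Finite and mildly infinite type

A function `f : [0, ∞) → [0, ∞)` is represented by a function `f : ℝ → ℝ`, of which only the values
on `Ici 0` are used. -/

/-- `f : [0, ∞) → [0, ∞)` is finite type at zero. -/
structure FiniteTypeAtZero (f : ℝ → ℝ) : Prop where
  mapsTo : MapsTo f (Ici 0) (Ici 0)
  continuousOn : ContinuousOn f (Ici 0)
  strictMonoOn : StrictMonoOn f (Ici 0)
  exists_lim : ∃ m > (1 : ℝ), ∃ c > (0 : ℝ), Tendsto (fun x => f x / x ^ m) (𝓝[>] 0) (𝓝 c)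

/-- The increasing function `g : [0, R] → ℝ` satisfies a doubling condition. -/
def SatisfiesDoubling (g : ℝ → ℝ) (R : ℝ) : Prop :=
  MonotoneOn g (Icc 0 R) ∧ g 0 = 0 ∧ ∃ σ > (1 : ℝ), ∀ x ∈ Icc 0 (R / σ), 2 * g x ≤ g (σ * x)

/-- `Λ_f(x) = -1 / log (f x)` for `x > 0`, and `Λ_f(0) = 0`. It is used only where `f x < 1`. -/
noncomputable def LambdaFun (f : ℝ → ℝ) (x : ℝ) : ℝ :=
  if x = 0 then 0 else -1 / Real.log (f x)

/-- `f : [0, ∞) → [0, ∞)` is mildly infinite type at zero. Since `f` is strictly increasing,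
`0 < R ∧ f R < 1` says `R ∈ (0, f⁻¹(1))`, with `f⁻¹(1) = ∞` if `f < 1` everywhere, as is the case
for `f x = exp (-1 / x ^ p)`. -/
structure MildlyInfiniteTypeAtZero (f : ℝ → ℝ) : Prop where
  mapsTo : MapsTo f (Ici 0) (Ici 0)
  smooth : ContDiffOn ℝ ∞ f (Ici 0)
  strictMonoOn : StrictMonoOn f (Ici 0)
  flat : ∀ l : ℕ, iteratedDerivWithin l f (Ici 0) 0 = 0
  doubling : ∃ R : ℝ, 0 < R ∧ f R < 1 ∧ SatisfiesDoubling (LambdaFun f) R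

/-! ### Extended generalized decoupled domains -/

/-- The first `m` coordinates `z'` of `z = (z', z_{m+1}) ∈ ℂ^{m+1}`. -/
noncomputable def tangentialPart {m : ℕ} (z : EuclideanSpace ℂ (Fin (m + 1))) :
    EuclideanSpace ℂ (Fin m) :=
  WithLp.toLp 2 fun i => z i.castSucc

/-- The `2m` real coordinates of a point of `ℂ^m`: `inl i` is the real part and `inr i` the
imaginary part of the `i`-th complex coordinate. -/
def realCoord {m : ℕ} (w : EuclideanSpace ℂ (Fin m)) : Fin m ⊕ Fin m → ℝ :=
  Sum.elim (fun i => (w i).re) (fun i => (w i).im)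

/-- The block `s^j ∈ ℝ^{d j}` of `w = (s^1, …, s^k) ∈ ℝ^{d 1} × ⋯ × ℝ^{d k}`. The bijection `e` says
which real coordinate of `w` is the `i`-th entry of the block `s^j`. -/
noncomputable def realBlock {m k : ℕ} {d : Fin k → ℕ}
    (e : (Σ j : Fin k, Fin (d j)) ≃ Fin m ⊕ Fin m) (w : EuclideanSpace ℂ (Fin m)) (j : Fin k) :
    EuclideanSpace ℝ (Fin (d j)) :=
  WithLp.toLp 2 fun i => realCoord w (e ⟨j, i⟩)

/-- `F(z') = f_1(|s^1|) + ⋯ + f_k(|s^k|)`. -/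
noncomputable def decoupledSum {m k : ℕ} {d : Fin k → ℕ}
    (e : (Σ j : Fin k, Fin (d j)) ≃ Fin m ⊕ Fin m) (f : Fin k → ℝ → ℝ)
    (w : EuclideanSpace ℂ (Fin m)) : ℝ :=
  ∑ j, f j ‖realBlock e w j‖

/-- `D ⊆ ℂ^{m+1}` is an extended generalized decoupled domain near `0`, with real blocks given by
`e`, profile functions `f j` and constant `δ`. -/
structure IsExtendedDecoupledNearZero {m k : ℕ} (D : Set (EuclideanSpace ℂ (Fin (m + 1))))
    {d : Fin k → ℕ} (e : (Σ j : Fin k, Fin (d j)) ≃ Fin m ⊕ Fin m) (f : Fin k → ℝ → ℝ)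
    (δ : ℝ) : Prop where
  blocks_pos : 0 < k
  dim_pos : ∀ j, 0 < d j
  type_at_zero : ∀ j, FiniteTypeAtZero (f j) ∨ MildlyInfiniteTypeAtZero (f j)
  smooth : ContDiff ℝ ∞ (decoupledSum e f)
  delta_pos : 0 < δ
  subset_half : ∀ z ∈ D, 0 < (z (Fin.last m)).re
  exists_nhd : ∃ U ∈ 𝓝 (0 : EuclideanSpace ℂ (Fin (m + 1))),
    D ∩ U = {z ∈ U | decoupledSum e f (tangentialPart z) < (z (Fin.last m)).re} ∧
    D ∩ Uᶜ ⊆ {z ∈ D | δ < ‖z (Fin.last m)‖}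

/-- The boundary of the open set `D` is `C²`-smooth: near each of its points `D` is a sublevel set
`{ρ < 0}` of a `C²` function with non-vanishing differential. -/
def HasC2Boundary {n : ℕ} (D : Set (EuclideanSpace ℂ (Fin n))) : Prop :=
  ∀ p ∈ frontier D, ∃ (V : Set (EuclideanSpace ℂ (Fin n))) (ρ : EuclideanSpace ℂ (Fin n) → ℝ),
    IsOpen V ∧ p ∈ V ∧ ContDiffOn ℝ 2 ρ V ∧ (∀ z ∈ V, fderiv ℝ ρ z ≠ 0) ∧
      D ∩ V = {z ∈ V | ρ z < 0}

/-! ### The Bergman kernel -/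

/-- The Bergman space `A²(D)`. -/
def MemBergman {n : ℕ} (D : Set (EuclideanSpace ℂ (Fin n))) (f : EuclideanSpace ℂ (Fin n) → ℂ) :
    Prop :=
  DifferentiableOn ℂ f D ∧ MemLp f 2 (volume.restrict D)

/-- `K` is the Bergman kernel of `D`; only its values on `D × D` matter. -/
structure IsBergmanKernel {n : ℕ} (D : Set (EuclideanSpace ℂ (Fin n)))
    (K : EuclideanSpace ℂ (Fin n) → EuclideanSpace ℂ (Fin n) → ℂ) : Prop where
  mem : ∀ w ∈ D, MemBergman D fun z => K z w
  conj_symm : ∀ z ∈ D, ∀ w ∈ D, star (K z w) = K w z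
  reproducing : ∀ f, MemBergman D f → ∀ z ∈ D, f z = ∫ w in D, K z w * f w

/-- The Bergman kernel on the diagonal as an extremal value,
`κ_D(z) = sup {|f(z)|² : f ∈ A²(D), ‖f‖_{L²(D)} ≤ 1}`. -/
noncomputable def bergmanDiag {n : ℕ} (D : Set (EuclideanSpace ℂ (Fin n)))
    (z : EuclideanSpace ℂ (Fin n)) : ℝ≥0∞ :=
  ⨆ (f : EuclideanSpace ℂ (Fin n) → ℂ) (_ : MemBergman D f)
    (_ : ∫⁻ w in D, ‖f w‖ₑ ^ 2 ≤ 1), ‖f z‖ₑ ^ 2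

/-! ### The Szegő kernel -/

/-- The surface measure of the real hypersurface `M ⊆ ℂ^n`: the `(2n-1)`-dimensional Hausdorff
measure, normalized to agree with Lebesgue measure on `ℝ^{2n-1}`. -/
noncomputable def surfaceMeasure {n : ℕ} (M : Set (EuclideanSpace ℂ (Fin n))) :
    Measure (EuclideanSpace ℂ (Fin n)) :=
  (μHE[2 * n - 1]).restrict M

/-- `D_ε`, the set of points of `D` at distance greater than `ε` from the boundary. -/
def innerDomain {n : ℕ} (D : Set (EuclideanSpace ℂ (Fin n))) (ε : ℝ) :
    Set (EuclideanSpace ℂ (Fin n)) :=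
  {z ∈ D | ε < Metric.infDist z (frontier D)}

/-- `‖f‖²_{H²(D)}`, the upper limit as `ε → 0⁺` of the integrals of `|f|²` over `bD_ε`. -/
noncomputable def hardyNormSq {n : ℕ} (D : Set (EuclideanSpace ℂ (Fin n)))
    (f : EuclideanSpace ℂ (Fin n) → ℂ) : ℝ≥0∞ :=
  limsup (fun ε : ℝ => ∫⁻ w, ‖f w‖ₑ ^ 2 ∂surfaceMeasure (frontier (innerDomain D ε))) (𝓝[>] 0)

/-- The Hardy space `H²(D)`. -/
def MemHardy {n : ℕ} (D : Set (EuclideanSpace ℂ (Fin n))) (f : EuclideanSpace ℂ (Fin n) → ℂ) :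
    Prop :=
  DifferentiableOn ℂ f D ∧ hardyNormSq D f < ⊤

/-- At almost every boundary point, `g` is the non-tangential limit of `f`. -/
def IsBoundaryValue {n : ℕ} (D : Set (EuclideanSpace ℂ (Fin n)))
    (f g : EuclideanSpace ℂ (Fin n) → ℂ) : Prop :=
  ∀ᵐ ξ ∂surfaceMeasure (frontier D), ∀ α : ℝ,
    Tendsto f (𝓝[{w ∈ D | ‖w - ξ‖ < α * Metric.infDist w (frontier D)}] ξ) (𝓝 (g ξ))

/-- `S` is the Szegő kernel of `D`, the reproducing kernel of `H²(D)`. The values `S z ξ` with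
`z ∈ D` and `ξ ∈ bD` are the boundary values of `S z`; other values off `D × D` do not matter. -/
structure IsSzegoKernel {n : ℕ} (D : Set (EuclideanSpace ℂ (Fin n)))
    (S : EuclideanSpace ℂ (Fin n) → EuclideanSpace ℂ (Fin n) → ℂ) : Prop where
  mem : ∀ w ∈ D, MemHardy D fun z => S z w
  conj_symm : ∀ z ∈ D, ∀ w ∈ D, star (S z w) = S w z
  boundary : ∀ z ∈ D, IsBoundaryValue D (S z) (S z)
  boundary_memLp : ∀ z ∈ D, MemLp (S z) 2 (surfaceMeasure (frontier D))
  reproducing : ∀ f fstar, MemHardy D f → IsBoundaryValue D f fstar → ∀ z ∈ D,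
    f z = ∫ ξ, fstar ξ * S z ξ ∂surfaceMeasure (frontier D)

/-- The Szegő kernel on the diagonal as an extremal value,
`𝒮_D(z) = sup {|f(z)|² : f ∈ H²(D), ‖f‖_{H²(D)} ≤ 1}`. -/
noncomputable def szegoDiag {n : ℕ} (D : Set (EuclideanSpace ℂ (Fin n)))
    (z : EuclideanSpace ℂ (Fin n)) : ℝ≥0∞ :=
  ⨆ (f : EuclideanSpace ℂ (Fin n) → ℂ) (_ : MemHardy D f) (_ : hardyNormSq D f ≤ 1), ‖f z‖ₑ ^ 2

/-! ### The lower bound -/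

/-- `∏_j [f_j⁻¹(t)]^{-d_j}`, where `f_j⁻¹` is the inverse of `f_j : [0, ∞) → [0, ∞)`. It is used only
for `t` in the range of every `f_j`. -/
noncomputable def inverseProduct {k : ℕ} (d : Fin k → ℕ) (f : Fin k → ℝ → ℝ) (t : ℝ) : ℝ :=
  ∏ j, (Function.invFunOn (f j) (Ici 0) t) ^ (-(d j : ℤ))

/-! Test both kernels on h(w) = (w_n + ζ)^{-N}, where ζ is the conjugate of z_n and t = Re z_n.
Since Re w_n ≥ 0 on the closure of D, |w_n + ζ| ≥ t there, so h is holomorphic on D and continuous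
up to the boundary, while |h(z)|² = (2t)^{-2N}. It remains to bound the norm of h by cutting into
shells where |w_n + ζ| is about 2^i t.

Put s_j = f_j⁻¹(t). Both types give 2 f_j(s) ≤ f_j(A s) for small s. Near 0, a point of the i-th
shell has f_j(|s^j|) ≤ Re w_n < 2^i t, whence |s^j| is at most a constant times A^i s_j; away from
0, |w_n| > δ makes 2^i t bounded below and the bound follows from the boundedness of D
(`exists_norm_realBlock_le`). So a shell has volume at most a constant times (2^i t)² G^i ∏
s_j^{d_j}, with G = A^{∑ d_j}. If 4^N is large against G, the sum over shells is a convergent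
geometric series (`lintegral_inv_pow_le`).

For the Szegő kernel the same is needed for surface measure, with (2^i t)² replaced by 2^i t,
uniformly over the boundaries of the inner domains. These are locally Lipschitz graphs with uniform
constants (`exists_abs_fderiv_sub_le`). Where Re w_n = 0 the inclusion of D in a half space lets Re
w_n be the graph direction (`fderiv_normalVec_ne_zero`); elsewhere only shells with 2^i t bounded
below occur, and a crude bound is enough. -/

/-! ### Growth of the profile functions -/

/-- The common properties of profile functions used in the estimates. -/
structure ProfileGrowth (f : ℝ → ℝ) (A s₀ : ℝ) : Prop where
  strictMonoOn : StrictMonoOn f (Ici 0)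
  zero : f 0 = 0
  one_le : 1 ≤ A
  pos : 0 < s₀
  two_mul_le : ∀ s, 0 < s → s < s₀ → 2 * f s ≤ f (A * s)

theorem ProfileGrowth.mono {f : ℝ → ℝ} {A A' s₀ s₀' : ℝ} (h : ProfileGrowth f A s₀) (hA : A ≤ A')
    (hs : 0 < s₀') (hs' : s₀' ≤ s₀) : ProfileGrowth f A' s₀' where
  strictMonoOn := h.strictMonoOn
  zero := h.zero
  one_le := h.one_le.trans hA
  pos := hs
  two_mul_le s h0 h1 := by
    refine (h.two_mul_le s h0 (h1.trans_le hs')).trans ?_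
    have hA0 := h.one_le
    exact h.strictMonoOn.monotoneOn (mem_Ici.2 (by positivity))
      (mem_Ici.2 (mul_nonneg (by linarith) h0.le)) (by gcongr)

theorem ProfileGrowth.nonneg {f : ℝ → ℝ} {A s₀ : ℝ} (h : ProfileGrowth f A s₀) {s : ℝ}
    (hs : 0 ≤ s) : 0 ≤ f s := by
  rw [← h.zero]
  exact h.strictMonoOn.monotoneOn (mem_Ici.2 le_rfl) hs hs

/-- Near 0 the ratio f x / x^m lies in (c/2, 2c), and m > 1 gives 8^m ≥ 8, so f (8 s) ≥ 4 c s^m ≥ 2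
f s. -/
theorem FiniteTypeAtZero.exists_growth {f : ℝ → ℝ} (h : FiniteTypeAtZero f) :
    ∃ A s₀, ProfileGrowth f A s₀ := by
  obtain ⟨m, hm, c, hc, hlim⟩ := h.exists_lim
  have hzero : f 0 = 0 := by
    have h1 : Tendsto f (𝓝[>] 0) (𝓝 (f 0)) :=
      ((h.continuousOn 0 (mem_Ici.2 le_rfl)).mono_left
        (nhdsWithin_mono _ Ioi_subset_Ici_self))
    have h2 : Tendsto (fun x : ℝ => x ^ m) (𝓝[>] 0) (𝓝 0) := by
      have := (Real.continuousAt_rpow_const 0 m (Or.inr (by linarith))).tendsto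
      rw [Real.zero_rpow (by linarith)] at this
      exact this.mono_left nhdsWithin_le_nhds
    have h3 : Tendsto f (𝓝[>] 0) (𝓝 (c * 0)) := by
      refine (hlim.mul h2).congr' ?_
      filter_upwards [self_mem_nhdsWithin] with x hx
      have : x ^ m ≠ 0 := (Real.rpow_pos_of_pos hx m).ne'
      field_simp
    simpa using tendsto_nhds_unique h1 h3
  have hev : ∀ᶠ x in 𝓝[>] (0 : ℝ), f x / x ^ m ∈ Ioo (c / 2) (2 * c) :=
    hlim.eventually (Ioo_mem_nhds (by linarith) (by linarith))
  obtain ⟨u, hu, hsub⟩ := mem_nhdsGT_iff_exists_Ioo_subset.1 hev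
  have hu' : (0 : ℝ) < u := hu
  refine ⟨8, u / 8, h.strictMonoOn, hzero, by norm_num, by positivity, fun s hs hsu => ?_⟩
  have h1 := (hsub (show s ∈ Ioo 0 u from ⟨hs, by linarith⟩)).2
  have h2 := (hsub (show 8 * s ∈ Ioo 0 u from ⟨by linarith, by linarith⟩)).1
  have hsm : 0 < s ^ m := Real.rpow_pos_of_pos hs m
  rw [div_lt_iff₀ hsm] at h1
  rw [Real.mul_rpow (by norm_num) hs.le, lt_div_iff₀ (by positivity)] at h2
  have h8 : (8 : ℝ) ≤ 8 ^ m := by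
    simpa using Real.rpow_le_rpow_of_exponent_le (x := 8) (by norm_num) hm.le
  have : c / 2 * (8 * s ^ m) ≤ c / 2 * (8 ^ m * s ^ m) := by gcongr
  linarith

/-- Doubling of Λ_f says log f(s) ≤ 2 log f(σs), that is f(s) ≤ f(σs)². Where f(σs) < 1/2 this is
stronger than the required factor 2. -/
theorem MildlyInfiniteTypeAtZero.exists_growth {f : ℝ → ℝ} (h : MildlyInfiniteTypeAtZero f) :
    ∃ A s₀, ProfileGrowth f A s₀ := by
  have hzero : f 0 = 0 := by simpa using h.flat 0
  obtain ⟨R, hR, hfR, -, -, σ, hσ, hdoub⟩ := h.doubling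
  have hcont : Tendsto f (𝓝[≥] 0) (𝓝 0) := by
    simpa [hzero, ContinuousWithinAt] using h.smooth.continuousOn 0 (mem_Ici.2 le_rfl)
  have hev : ∀ᶠ x in 𝓝[≥] (0 : ℝ), f x < 1 / 2 := hcont.eventually (gt_mem_nhds (by norm_num))
  obtain ⟨u, hu, hsub⟩ := mem_nhdsGE_iff_exists_Ico_subset.1 hev
  have hu' : (0 : ℝ) < u := hu
  refine ⟨σ, min (u / σ) (R / σ), h.strictMonoOn, hzero, hσ.le, by positivity,
    fun s hs hsu => ?_⟩
  obtain ⟨hsu, hsR⟩ := lt_min_iff.1 hsu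
  have hσs : σ * s < u := by rwa [lt_div_iff₀ (by positivity), mul_comm] at hsu
  have hσR : σ * s < R := by rwa [lt_div_iff₀ (by positivity), mul_comm] at hsR
  have hσs0 : 0 < σ * s := by positivity
  have hhalf : f (σ * s) < 1 / 2 := hsub ⟨hσs0.le, hσs⟩
  have hfs : 0 < f s := by
    rw [← hzero]; exact h.strictMonoOn (mem_Ici.2 le_rfl) (mem_Ici.2 hs.le) hs
  have hle : f s ≤ f (σ * s) := h.strictMonoOn.monotoneOn (mem_Ici.2 hs.le) (mem_Ici.2 hσs0.le)
    (by nlinarith)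
  have hd := hdoub s ⟨hs.le, hsR.le⟩
  simp only [LambdaFun, hs.ne', hσs0.ne', if_false] at hd
  have hl1 : Real.log (f s) < 0 := Real.log_neg hfs (by linarith)
  have hl2 : Real.log (f (σ * s)) < 0 := Real.log_neg (by linarith) (by linarith)
  have hlog : 2 * Real.log (f (σ * s)) ≥ Real.log (f s) := by
    have e1 : -1 / Real.log (f s) = 1 / (-Real.log (f s)) := by rw [div_neg, neg_div]
    have e2 : -1 / Real.log (f (σ * s)) = 1 / (-Real.log (f (σ * s))) := by rw [div_neg, neg_div]
    rw [e1, e2, mul_one_div, div_le_div_iff₀ (by linarith) (by linarith)] at hd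
    linarith
  have hsq : f s ≤ f (σ * s) ^ 2 := by
    rw [← Real.log_le_log_iff hfs (pow_pos (by linarith) 2), Real.log_pow]
    exact_mod_cast hlog
  nlinarith

namespace ProfileGrowth

variable {f : ℝ → ℝ} {A s₀ : ℝ}

/-- Iterates `two_mul_le`, which is available only below `s₀`; once A^i s has passed `s₀` it stays
above it because A ≥ 1. -/
theorem pow_mul_le (h : ProfileGrowth f A s₀) {s : ℝ} (hs : 0 < s) (i : ℕ) :
    s₀ ≤ A ^ i * s ∨ 2 ^ i * f s ≤ f (A ^ i * s) := by
  have hA := h.one_le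
  induction i with
  | zero => right; simp
  | succ i ih =>
    by_cases h0 : s₀ ≤ A ^ i * s
    · left
      refine h0.trans ?_
      gcongr
      omega
    · right
      have h1 := ih.resolve_left h0
      have h2 := h.two_mul_le (A ^ i * s) (by positivity) (not_le.1 h0)
      rw [pow_succ, pow_succ', mul_assoc A]
      linarith

/-- If `f r < 2 ^ i * f s`, then `r ≤ B * A ^ i * s` for `r` in a bounded range. -/
theorem le_of_lt (h : ProfileGrowth f A s₀) {R₀ B : ℝ} (hB1 : 1 ≤ B)
    (hB : R₀ ≤ B * s₀) {s r : ℝ} (hs : 0 < s) (hr : 0 ≤ r) (hrR : r ≤ R₀) {i : ℕ}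
    (hlt : f r < 2 ^ i * f s) : r ≤ B * A ^ i * s := by
  have hA := h.one_le
  rcases h.pow_mul_le hs i with h1 | h1
  · calc r ≤ B * s₀ := hrR.trans hB
      _ ≤ B * (A ^ i * s) := by gcongr
      _ = _ := by ring
  · have : r < A ^ i * s := by
      rw [← h.strictMonoOn.lt_iff_lt (mem_Ici.2 hr) (mem_Ici.2 (by positivity))]
      linarith
    calc r ≤ 1 * (A ^ i * s) := by linarith
      _ ≤ B * (A ^ i * s) := by gcongr
      _ = _ := by ring

/-- A bound for the whole range, once `2 ^ i * f s` is bounded below. -/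
theorem exists_range_le (h : ProfileGrowth f A s₀) {R₀ : ℝ} (hR : 0 ≤ R₀) {c : ℝ} (hc : 0 < c) :
    ∃ B, 0 < B ∧ ∀ s, 0 < s → ∀ i : ℕ, c ≤ 2 ^ i * f s → R₀ ≤ B * A ^ i * s := by
  have hA := h.one_le
  have hs₀ := h.pos
  -- With p further doublings f R₀ < 2^(p+i) f s, so `le_of_lt` applies at r = R₀; the factor A^p
  -- goes into B.
  obtain ⟨p, hp⟩ := pow_unbounded_of_one_lt (f R₀ / c) (one_lt_two)
  rw [div_lt_iff₀ hc] at hp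
  refine ⟨max 1 (R₀ / s₀) * A ^ p, by positivity, fun s hs i hi => ?_⟩
  have := h.le_of_lt (R₀ := R₀) (B := max 1 (R₀ / s₀)) (le_max_left _ _)
    (by rw [← div_le_iff₀ hs₀]; exact le_max_right _ _) hs hR le_rfl (i := p + i) (by
      calc f R₀ < 2 ^ p * c := hp
        _ ≤ 2 ^ p * (2 ^ i * f s) := by gcongr
        _ = _ := by ring)
  calc R₀ ≤ _ := this
    _ = _ := by ring

end ProfileGrowth

/-- Finitely many profile functions satisfy the growth condition with the same constants. -/
theorem exists_common_growth {k : ℕ} {f : Fin k → ℝ → ℝ}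
    (h : ∀ j, FiniteTypeAtZero (f j) ∨ MildlyInfiniteTypeAtZero (f j)) :
    ∃ A s₀, 1 ≤ A ∧ 0 < s₀ ∧ ∀ j, ProfileGrowth (f j) A s₀ := by
  have h' : ∀ j, ∃ A s₀, ProfileGrowth (f j) A s₀ := fun j =>
    (h j).elim FiniteTypeAtZero.exists_growth MildlyInfiniteTypeAtZero.exists_growth
  choose A s hA using h'
  obtain ⟨M, hM⟩ := (finite_range A).bddAbove
  obtain ⟨σ, hσ0, hσ⟩ : ∃ σ > 0, ∀ j, σ ≤ s j := by
    have hne := ((finite_range s).insert 1)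
    obtain ⟨x, hx, hmin⟩ := Set.exists_min_image _ id hne ⟨1, mem_insert _ _⟩
    refine ⟨x, ?_, fun j => hmin _ (mem_insert_of_mem _ (mem_range_self j))⟩
    rcases hx with rfl | ⟨j, rfl⟩
    · norm_num
    · exact (hA j).pos
  refine ⟨max 1 M, σ, le_max_left _ _, hσ0, fun j => (hA j).mono ?_ hσ0 (hσ j)⟩
  exact (hM (mem_range_self j)).trans (le_max_right _ _)

/-! ### Summation over dyadic shells -/

theorem exists_dyadic {t x : ℝ} (ht : 0 < t) (hx : t ≤ x) :
    ∃ i : ℕ, 2 ^ i * t ≤ x ∧ x < 2 ^ (i + 1) * t := by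
  obtain ⟨i, h1, h2⟩ := exists_nat_pow_near (x := x / t) (y := 2)
    ((one_le_div ht).2 hx) one_lt_two
  exact ⟨i, (le_div_iff₀ ht).1 h1, (div_lt_iff₀ ht).1 h2⟩

/-- On the shell 2^i t ≤ φ < 2^(i+1) t the integrand is at most (2^i t)^(-2N), so the i-th term is a
constant times (2^q G / 4^N)^i ≤ 2^(-i). The exponent q is 2 for volume and 1 for surface measure.
-/
theorem lintegral_inv_pow_le {α : Type*} [MeasurableSpace α] {μ : Measure α} {φ : α → ℝ}
    (hφ : Measurable φ) {t M G P : ℝ} {q N : ℕ} (ht : 0 < t) (hM : 0 ≤ M) (hG : 0 ≤ G)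
    (hP : 0 ≤ P) (hN : 2 * (2 ^ q * G) ≤ 4 ^ N) (hlow : ∀ᵐ w ∂μ, t ≤ φ w)
    (hμ : ∀ i : ℕ, μ {w | φ w < 2 ^ i * t} ≤ ENNReal.ofReal (M * (2 ^ i * t) ^ q * (G ^ i * P))) :
    ∫⁻ w, ENNReal.ofReal ((φ w ^ (2 * N))⁻¹) ∂μ ≤
      ENNReal.ofReal (2 ^ (q + 1) * G * M * t ^ q * (t ^ (2 * N))⁻¹ * P) := by
  have hpt : ∀ᵐ w ∂μ, ENNReal.ofReal ((φ w ^ (2 * N))⁻¹) ≤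
      ∑' i : ℕ, {w | φ w < 2 ^ (i + 1) * t}.indicator
        (fun _ => ENNReal.ofReal (((2 ^ i * t) ^ (2 * N))⁻¹)) w := by
    filter_upwards [hlow] with w hw
    obtain ⟨i, h1, h2⟩ := exists_dyadic ht hw
    refine le_trans ?_ (ENNReal.le_tsum i)
    rw [indicator_of_mem (show w ∈ {w | φ w < 2 ^ (i + 1) * t} from h2)]
    apply ENNReal.ofReal_le_ofReal
    gcongr
  refine (lintegral_mono_ae hpt).trans ?_
  have hmeas : ∀ i : ℕ, MeasurableSet {w | φ w < 2 ^ (i + 1) * t} := fun i =>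
    measurableSet_lt hφ measurable_const
  rw [lintegral_tsum fun i => (measurable_const.indicator (hmeas i)).aemeasurable]
  -- The factor 2^q G comes from bounding the i-th shell by the sublevel set of index i + 1; the
  -- geometric series contributes the remaining 2.
  set K : ℝ := 2 ^ q * G * M * t ^ q * (t ^ (2 * N))⁻¹ * P with hK
  have hK0 : 0 ≤ K := by positivity
  have hterm : ∀ i : ℕ, ∫⁻ w, {w | φ w < 2 ^ (i + 1) * t}.indicator
        (fun _ => ENNReal.ofReal (((2 ^ i * t) ^ (2 * N))⁻¹)) w ∂μ ≤
      ENNReal.ofReal (K * (1 / 2) ^ i) := by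
    intro i
    rw [lintegral_indicator_const (hmeas i)]
    refine (mul_le_mul_right (hμ (i + 1)) _).trans ?_
    rw [← ENNReal.ofReal_mul (by positivity)]
    apply ENNReal.ofReal_le_ofReal
    have h4 : (2 ^ q * G) ^ i * ((4 ^ N) ^ i)⁻¹ ≤ (1 / 2) ^ i := by
      rw [← div_eq_mul_inv, ← div_pow]
      refine pow_le_pow_left₀ (by positivity) ?_ i
      rw [div_le_div_iff₀ (by positivity) (by positivity)]
      linarith
    calc ((2 ^ i * t) ^ (2 * N))⁻¹ * (M * (2 ^ (i + 1) * t) ^ q * (G ^ (i + 1) * P))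
        = K * ((2 ^ q * G) ^ i * ((4 ^ N) ^ i)⁻¹) := by
          have e : ((2 : ℝ) ^ i * t) ^ (2 * N) = (4 ^ N) ^ i * t ^ (2 * N) := by
            rw [mul_pow, ← pow_mul, ← pow_mul, show (4 : ℝ) = 2 ^ 2 by norm_num, ← pow_mul]
            ring_nf
          rw [e, hK, mul_inv]
          ring
      _ ≤ K * (1 / 2) ^ i := by gcongr
  refine (ENNReal.tsum_le_tsum hterm).trans ?_
  rw [← ENNReal.ofReal_tsum_of_nonneg (fun i => by positivity)
    (summable_geometric_two.mul_left K), tsum_mul_left, tsum_geometric_two]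
  apply ENNReal.ofReal_le_ofReal
  rw [hK]
  apply le_of_eq
  ring

/-! ### Local Lipschitz graphs -/

theorem le_infDist_frontier_of_ball_subset {E : Type*} [PseudoMetricSpace E] {D : Set E}
    (hD : IsOpen D) (hne : (frontier D).Nonempty) {x : E} {r : ℝ} (h : Metric.ball x r ⊆ D) :
    r ≤ Metric.infDist x (frontier D) := by
  refine (Metric.le_infDist hne).2 fun q hq => ?_
  by_contra hlt
  have hqD : q ∈ D := h (by rw [Metric.mem_ball, dist_comm]; linarith)
  exact (disjoint_frontier_iff_isOpen.2 hD).le_bot ⟨hq, hqD⟩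

theorem isOpen_setOf_lt_infDist {E : Type*} [PseudoMetricSpace E] {D : Set E} (hD : IsOpen D)
    (ε : ℝ) : IsOpen {z ∈ D | ε < Metric.infDist z (frontier D)} :=
  hD.inter (isOpen_lt continuous_const (Metric.continuous_infDist_pt _))

section Cone

variable {E F : Type*} [NormedAddCommGroup E] [NormedSpace ℝ E] [NormedAddCommGroup F]
  [NormedSpace ℝ F]

/-- The ball misses the frontier, so it is covered by the disjoint open sets D and the complement of
its closure; being connected, it stays on the side of its centre. -/
theorem ball_subset_of_le_infDist_frontier {D : Set E} (hD : IsOpen D) {x : E} {r : ℝ} (hx : x ∈ D)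
    (hr : r ≤ Metric.infDist x (frontier D)) : Metric.ball x r ⊆ D := by
  rcases le_or_gt r 0 with h0 | h0
  · simp [Metric.ball_eq_empty.2 h0]
  have hdisj : ∀ y ∈ Metric.ball x r, y ∉ frontier D := fun y hy hyf => by
    have := Metric.infDist_le_dist_of_mem (x := x) hyf
    rw [Metric.mem_ball, dist_comm] at hy
    linarith
  refine (convex_ball x r).isPreconnected.subset_left_of_subset_union hD
    isClosed_closure.isOpen_compl (disjoint_compl_right.mono_left subset_closure)
    (fun y hy => ?_) ⟨x, Metric.mem_ball_self h0, hx⟩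
  by_cases hyc : y ∈ closure D
  · left
    by_contra hyD
    exact hdisj y hy ⟨hyc, by rwa [hD.interior_eq]⟩
  · exact Or.inr hyc

/-- Near a boundary point with a strictly differentiable defining function, no two points of the
boundary of an inner domain differ by a vector in the cone where the differential is large. -/
theorem exists_abs_fderiv_sub_le {D V : Set E} (hD : IsOpen D) {p : E} (hp : p ∈ frontier D)
    (hV : V ∈ 𝓝 p) {ρ : E → ℝ} {ℓ : E →L[ℝ] ℝ} (hρ : HasStrictFDerivAt ρ ℓ p)
    (hDV : D ∩ V = {z ∈ V | ρ z < 0}) {a : ℝ} (ha : 0 < a) :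
    ∃ r > 0, ∀ ε, 0 ≤ ε → ε < r →
      ∀ x ∈ frontier {z ∈ D | ε < Metric.infDist z (frontier D)} ∩ Metric.ball p r,
      ∀ y ∈ frontier {z ∈ D | ε < Metric.infDist z (frontier D)} ∩ Metric.ball p r,
        |ℓ (y - x)| ≤ a * ‖y - x‖ := by
  obtain ⟨η₁, hη₁, h1⟩ := Metric.eventually_nhds_iff.1 (hρ.isLittleO.def ha)
  obtain ⟨η₂, hη₂, h2⟩ := Metric.mem_nhds_iff.1 hV
  -- The factor 4 leaves room for a point within 2r of p translated by a vector shorter than 2r.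
  obtain ⟨r, hr0, hr1, hr2⟩ : ∃ r > 0, 4 * r ≤ η₁ ∧ 4 * r ≤ η₂ :=
    ⟨min η₁ η₂ / 4, by positivity, by linarith [min_le_left η₁ η₂], by linarith [min_le_right η₁ η₂]⟩
  have hmem : ∀ u, dist u p < 4 * r → (u ∈ D ↔ ρ u < 0) := fun u hu => by
    have huV : u ∈ V := h2 (Metric.mem_ball.2 (hu.trans_le hr2))
    have := Set.ext_iff.1 hDV u
    simpa [huV] using this
  -- By strict differentiability, translation by v with ℓ v < -a‖v‖ lowers ρ, so it keeps points in
  -- D.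
  have hshift : ∀ u v : E, dist u p < 2 * r → u ∈ D → ‖v‖ < 2 * r → ℓ v < -(a * ‖v‖) →
      u + v ∈ D := fun u v hu huD hv hℓ => by
    have huv : dist (u + v) p < 4 * r := by
      have := dist_triangle (u + v) u p
      rw [dist_self_add_left] at this
      linarith
    have hu4 : dist u p < 4 * r := by linarith
    rw [hmem _ huv]
    rw [hmem _ hu4] at huD
    have := @h1 (u + v, u) (by
      rw [Prod.dist_eq]
      exact max_lt (huv.trans_le hr1) (hu4.trans_le hr1))
    simp only [add_sub_cancel_left, Real.norm_eq_abs] at this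
    linarith [(abs_le.1 this).2]
  refine ⟨r, hr0, fun ε hε0 hεr => ?_⟩
  have key : ∀ x ∈ frontier {z ∈ D | ε < Metric.infDist z (frontier D)} ∩ Metric.ball p r,
      ∀ y ∈ frontier {z ∈ D | ε < Metric.infDist z (frontier D)} ∩ Metric.ball p r,
        -(a * ‖y - x‖) ≤ ℓ (y - x) := by
    rintro x ⟨hx, hxr⟩ y ⟨hy, hyr⟩
    by_contra hlt
    -- The strict cone condition is open, so x may be replaced by a point x' of the inner domain
    -- itself. Translating the whole ball of radius ε' > ε about x' then puts y in the open inner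
    -- domain, contradicting that y is on its frontier.
    have hopen : IsOpen {x' | dist x' p < r ∧ ℓ (y - x') < -(a * ‖y - x'‖)} :=
      (isOpen_lt (by fun_prop) continuous_const).and (isOpen_lt (by fun_prop) (by fun_prop))
    obtain ⟨x', ⟨hx'r, hx'ℓ⟩, hx'D, hx'ε⟩ := mem_closure_iff.1 (frontier_subset_closure hx) _ hopen
      ⟨hxr, not_le.1 hlt⟩
    obtain ⟨ε', hε1, hε2⟩ := exists_between (lt_min hx'ε hεr)
    obtain ⟨hε3, hε4⟩ := lt_min_iff.1 hε2
    have hball : Metric.ball x' ε' ⊆ D := ball_subset_of_le_infDist_frontier hD hx'D hε3.le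
    have hyball : Metric.ball y ε' ⊆ D := fun w hw => by
      have hw' : dist (w - (y - x')) x' < ε' := by
        rw [dist_eq_norm] at *
        rwa [Metric.mem_ball, dist_eq_norm, show w - y = w - (y - x') - x' by abel] at hw
      have := hshift (w - (y - x')) (y - x') (by linarith [dist_triangle (w - (y - x')) x' p])
        (hball hw') (by
          rw [← dist_eq_norm]
          have h3 : dist y p < r := hyr
          linarith [dist_triangle_right y x' p]) hx'ℓ
      simpa using this
    have hε' : 0 < ε' := hε0.trans_lt hε1
    have hmemy : y ∈ {z ∈ D | ε < Metric.infDist z (frontier D)} :=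
      ⟨hyball (Metric.mem_ball_self hε'),
        hε1.trans_le (le_infDist_frontier_of_ball_subset hD ⟨p, hp⟩ hyball)⟩
    exact (disjoint_frontier_iff_isOpen.2 (isOpen_setOf_lt_infDist hD ε)).le_bot ⟨hy, hmemy⟩
  intro x hx y hy
  refine abs_le.2 ⟨key x hx y hy, ?_⟩
  have := key y hy x hx
  rw [← neg_sub y x, map_neg, norm_neg] at this
  linarith

/-- A continuous linear map which determines vectors up to multiples of `b` is bounded below on the
vectors where the functional `ℓ`, nonzero at `b`, is small. -/
theorem exists_norm_le_of_abs_le {Q : E →L[ℝ] F} {b : E} {φ : E → ℝ} {C : ℝ}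
    (hQ : ∀ v, ‖v - φ v • b‖ ≤ C * ‖Q v‖) (ℓ : E →L[ℝ] ℝ) (hb : ℓ b ≠ 0) :
    ∃ a > 0, ∃ L : NNReal, ∀ v, |ℓ v| ≤ a * ‖v‖ → ‖v‖ ≤ L * ‖Q v‖ := by
  have hb0 : b ≠ 0 := fun h => hb (by simp [h])
  have hbn : 0 < ‖b‖ := norm_pos_iff.2 hb0
  have hℓb : 0 < |ℓ b| := abs_pos.2 hb
  -- With this a, the component of v along b has norm at most ‖v‖/2 plus a multiple of ‖Q v‖, and
  -- the half is absorbed on the left.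
  refine ⟨|ℓ b| / (2 * ‖b‖), by positivity,
    Real.toNNReal (2 * (‖b‖ * ‖ℓ‖ * C / |ℓ b| + C)), fun v hv => ?_⟩
  have h1 : ‖v‖ ≤ |φ v| * ‖b‖ + C * ‖Q v‖ := by
    have := norm_add_le (φ v • b) (v - φ v • b)
    rw [add_sub_cancel, norm_smul, Real.norm_eq_abs] at this
    linarith [hQ v]
  have h2 : |φ v| * |ℓ b| ≤ |ℓ b| / (2 * ‖b‖) * ‖v‖ + ‖ℓ‖ * (C * ‖Q v‖) := by
    have e : φ v * ℓ b = ℓ v - ℓ (v - φ v • b) := by simp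
    rw [← abs_mul, e]
    refine (abs_sub _ _).trans (add_le_add hv ?_)
    exact (ℓ.le_opNorm _).trans (by gcongr; exact hQ v)
  have h3 : |φ v| * ‖b‖ ≤ ‖v‖ / 2 + ‖b‖ * ‖ℓ‖ * C / |ℓ b| * ‖Q v‖ := by
    have := mul_le_mul_of_nonneg_left h2 (show 0 ≤ ‖b‖ / |ℓ b| by positivity)
    calc |φ v| * ‖b‖ = ‖b‖ / |ℓ b| * (|φ v| * |ℓ b|) := by field_simp
      _ ≤ _ := this
      _ = _ := by field_simp
  refine le_trans ?_ (mul_le_mul_of_nonneg_right (Real.le_coe_toNNReal _) (norm_nonneg _))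
  nlinarith

/-- Q is antilipschitz only on S, so the estimate is made on the subtype, whose inclusion is an
isometry and preserves Hausdorff measure. -/
theorem hausdorffMeasure_le_image [MeasurableSpace E] [BorelSpace E] [MeasurableSpace F]
    [BorelSpace F] {Q : E →L[ℝ] F} {L : NNReal} {S : Set E}
    (hS : ∀ x ∈ S, ∀ y ∈ S, ‖y - x‖ ≤ L * ‖Q (y - x)‖) {d : ℝ} (hd : 0 ≤ d) :
    μH[d] S ≤ (L : ℝ≥0∞) ^ d * μH[d] (Q '' S) := by
  have hanti : AntilipschitzWith L (fun x : S => Q x) :=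
    AntilipschitzWith.of_le_mul_dist fun x y => by
      rw [Subtype.dist_eq, dist_eq_norm, dist_eq_norm, ← map_sub]
      exact hS y y.2 x x.2
  have h1 := hanti.le_hausdorffMeasure_image hd (univ : Set S)
  have h2 : μH[d] ((Subtype.val : S → E) '' univ) = μH[d] (univ : Set S) :=
    isometry_subtype_coe.hausdorffMeasure_image (Or.inl hd) _
  rw [← h2, image_univ, Subtype.range_coe] at h1
  have e : (fun x : S => Q x) '' univ = Q '' S := by
    rw [image_univ]; ext z; simp
  rwa [e] at h1

end Cone

/-! ### Real coordinates and boxes -/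

/-- On ι → ℝ with the sup norm the Hausdorff measure of full dimension is Lebesgue measure; the Haar
factor is the normalization of `μHE`. -/
theorem euclideanHausdorffMeasure_le_image {E ι : Type*} [NormedAddCommGroup E] [NormedSpace ℝ E]
    [MeasurableSpace E] [BorelSpace E] [Fintype ι] {d : ℕ} (hd : Fintype.card ι = d)
    {Q : E →L[ℝ] (ι → ℝ)} {L : NNReal} {S : Set E}
    (hS : ∀ x ∈ S, ∀ y ∈ S, ‖y - x‖ ≤ L * ‖Q (y - x)‖) :
    (μHE[d] : Measure E) S ≤
      ((volume : Measure (EuclideanSpace ℝ (Fin d))).addHaarScalarFactor μH[d] * L ^ d : NNReal) *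
        volume (Q '' S) := by
  rw [Measure.euclideanHausdorffMeasure_def, Measure.smul_apply]
  have := hausdorffMeasure_le_image hS (d := d) (by positivity)
  rw [← hd, hausdorffMeasure_pi_real, hd, ENNReal.rpow_natCast] at this
  rw [ENNReal.coe_mul, mul_assoc, ENNReal.smul_def, smul_eq_mul, ENNReal.coe_pow]
  gcongr

section Coordinates

variable {m k : ℕ} {d : Fin k → ℕ} (e : (Σ j : Fin k, Fin (d j)) ≃ Fin m ⊕ Fin m)

/-- All real coordinates of `w ∈ ℂ^{m+1}` except `Re w_{m+1}`. -/
noncomputable def graphCoord :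
    EuclideanSpace ℂ (Fin (m + 1)) →L[ℝ] (Option (Σ j : Fin k, Fin (d j)) → ℝ) :=
  LinearMap.toContinuousLinearMap
    { toFun := fun w o => o.elim (w (Fin.last m)).im fun c => realCoord (tangentialPart w) (e c)
      map_add' := fun v w => by
        ext o
        rcases o with _ | c
        · simp
        · rcases h : e c with i | i <;> simp [h, realCoord, tangentialPart]
      map_smul' := fun r w => by
        ext o
        rcases o with _ | c
        · simp
        · rcases h : e c with i | i <;> simp [h, realCoord, tangentialPart] }

theorem graphCoord_none (w : EuclideanSpace ℂ (Fin (m + 1))) :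
    graphCoord e w none = (w (Fin.last m)).im := rfl

theorem graphCoord_some (w : EuclideanSpace ℂ (Fin (m + 1))) (j : Fin k) (i : Fin (d j)) :
    graphCoord e w (some ⟨j, i⟩) = realBlock e (tangentialPart w) j i := rfl

/-- All real coordinates of `w ∈ ℂ^{m+1}`. -/
noncomputable def fullCoord :
    EuclideanSpace ℂ (Fin (m + 1)) →L[ℝ] (Option (Option (Σ j : Fin k, Fin (d j))) → ℝ) :=
  LinearMap.toContinuousLinearMap
    { toFun := fun w o => o.elim (w (Fin.last m)).re (graphCoord e w)
      map_add' := fun v w => by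
        ext o
        rcases o with _ | c <;> simp
      map_smul' := fun r w => by
        ext o
        rcases o with _ | c <;> simp }

theorem fullCoord_none (w : EuclideanSpace ℂ (Fin (m + 1))) :
    fullCoord e w none = (w (Fin.last m)).re := rfl

theorem fullCoord_some (w : EuclideanSpace ℂ (Fin (m + 1))) (o) :
    fullCoord e w (some o) = graphCoord e w o := rfl

theorem fullCoord_injective : Function.Injective (fullCoord e) := by
  rw [injective_iff_map_eq_zero]
  intro w hw
  have hre : (w (Fin.last m)).re = 0 := by rw [← fullCoord_none e, hw]; rfl
  have him : (w (Fin.last m)).im = 0 := by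
    rw [← graphCoord_none e, ← fullCoord_some e, hw]; rfl
  have hc : ∀ c, realCoord (tangentialPart w) c = 0 := fun c => by
    have : fullCoord e w (some (some (e.symm c))) = 0 := by rw [hw]; rfl
    have h2 : fullCoord e w (some (some (e.symm c))) = realCoord (tangentialPart w) (e (e.symm c)) :=
      rfl
    rwa [h2, e.apply_symm_apply] at this
  ext i
  induction i using Fin.lastCases with
  | last => exact Complex.ext hre him
  | cast i => exact Complex.ext (hc (Sum.inl i)) (hc (Sum.inr i))

theorem exists_norm_le_fullCoord : ∃ L : NNReal, ∀ v, ‖v‖ ≤ L * ‖fullCoord e v‖ := by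
  obtain ⟨L, -, hL⟩ := (fullCoord e).toLinearMap.exists_antilipschitzWith
    (LinearMap.ker_eq_bot.2 (fullCoord_injective e))
  exact ⟨L, fun v => by simpa using hL.le_mul_dist v 0⟩

/-- The unit vector in the direction of `Re z_{m+1}`. -/
noncomputable def normalVec (m : ℕ) : EuclideanSpace ℂ (Fin (m + 1)) :=
  EuclideanSpace.single (Fin.last m) 1

/-- Removing the `normalVec` component leaves only the coordinates recorded by `graphCoord`. This is
the input `exists_norm_le_of_abs_le` needs. -/
theorem exists_norm_sub_le_graphCoord :
    ∃ C : ℝ, ∀ v, ‖v - (v (Fin.last m)).re • normalVec m‖ ≤ C * ‖graphCoord e v‖ := by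
  obtain ⟨L, hL⟩ := exists_norm_le_fullCoord e
  refine ⟨L, fun v => (hL _).trans ?_⟩
  gcongr
  rw [pi_norm_le_iff_of_nonneg (norm_nonneg _)]
  intro o
  rcases o with _ | _ | c
  · simp [fullCoord_none, normalVec]
  · have := norm_le_pi_norm (graphCoord e v) none
    simpa [fullCoord_some, graphCoord_none, normalVec] using this
  · have := norm_le_pi_norm (graphCoord e v) (some c)
    obtain ⟨j, i⟩ := c
    have h2 : graphCoord e (normalVec m) (some ⟨j, i⟩) = 0 := by
      show realCoord _ _ = 0
      rcases h : e ⟨j, i⟩ with i | i <;>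
        simp [realCoord, tangentialPart, normalVec]
    rw [fullCoord_some, map_sub, map_smul, Pi.sub_apply, Pi.smul_apply, h2, smul_zero, sub_zero]
    exact this

theorem card_option_sigma (e : (Σ j : Fin k, Fin (d j)) ≃ Fin m ⊕ Fin m) :
    Fintype.card (Option (Σ j : Fin k, Fin (d j))) = 2 * (m + 1) - 1 := by
  rw [Fintype.card_option, Fintype.card_congr e, Fintype.card_sum, Fintype.card_fin]
  omega

theorem card_option_option_sigma
    (e : (Σ j : Fin k, Fin (d j)) ≃ Fin m ⊕ Fin m) :
    Fintype.card (Option (Option (Σ j : Fin k, Fin (d j)))) = 2 * (m + 1) := by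
  rw [Fintype.card_option, card_option_sigma e]
  omega

theorem volume_eq_euclideanHausdorffMeasure (n : ℕ) :
    (volume : Measure (EuclideanSpace ℂ (Fin n))) = μHE[2 * n] := by
  rw [← InnerProductSpace.euclideanHausdorffMeasure_eq_volume]
  congr 1
  have := finrank_real_of_complex (EuclideanSpace ℂ (Fin n))
  rw [finrank_euclideanSpace_fin] at this
  exact this

variable {e} {S : Set (EuclideanSpace ℂ (Fin (m + 1)))} {ζ : ℂ} {r : ℝ} {s : Fin k → ℝ}

theorem prod_ofReal_graph (hs : ∀ j, 0 ≤ s j) (hr : 0 ≤ r) :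
    ∏ o : Option (Σ j : Fin k, Fin (d j)), ENNReal.ofReal (2 * o.elim r fun c => s c.1) =
      ENNReal.ofReal (2 * r * ∏ j, (2 * s j) ^ d j) := by
  rw [← ENNReal.ofReal_prod_of_nonneg]
  · rw [Fintype.prod_option, Fintype.prod_sigma]
    simp
  · rintro (_ | c) -
    · simpa using hr
    · simpa using hs c.1

/-- The image lies in a box. Only the imaginary part of the last coordinate is recorded, so r enters
to the first power, the source of the exponent -1 in the Szegő bound. -/
theorem volume_graphCoord_image_le (hr : 0 ≤ r) (hs : ∀ j, 0 ≤ s j)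
    (hS : ∀ w ∈ S, ‖w (Fin.last m) + ζ‖ ≤ r)
    (hS' : ∀ w ∈ S, ∀ j, ‖realBlock e (tangentialPart w) j‖ ≤ s j) :
    volume (graphCoord e '' S) ≤ ENNReal.ofReal (2 * r * ∏ j, (2 * s j) ^ d j) := by
  rw [← prod_ofReal_graph hs hr]
  have hsub : graphCoord e '' S ⊆ Icc (fun o => o.elim (-ζ.im - r) fun c => -s c.1)
      (fun o => o.elim (-ζ.im + r) fun c => s c.1) := by
    rintro _ ⟨w, hw, rfl⟩
    rw [mem_Icc, Pi.le_def, Pi.le_def, ← forall_and]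
    rintro (_ | ⟨j, i⟩)
    · have h1 := abs_le.1 ((Complex.abs_im_le_norm _).trans (hS w hw))
      rw [Complex.add_im] at h1
      simp only [graphCoord_none, Option.elim_none]
      constructor <;> linarith
    · rw [graphCoord_some]
      exact abs_le.1 ((PiLp.norm_apply_le _ i).trans (hS' w hw j))
  refine (measure_mono hsub).trans (le_of_eq ?_)
  rw [Real.volume_Icc_pi]
  refine Finset.prod_congr rfl fun o _ => ?_
  congr 1
  rcases o with _ | c <;> simp <;> ring

/-- Here both parts of the last coordinate have range of length 2r, the source of the exponent -2 in
the Bergman bound. -/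
theorem volume_fullCoord_image_le (hr : 0 ≤ r) (hs : ∀ j, 0 ≤ s j)
    (hS : ∀ w ∈ S, ‖w (Fin.last m) + ζ‖ ≤ r)
    (hS' : ∀ w ∈ S, ∀ j, ‖realBlock e (tangentialPart w) j‖ ≤ s j) :
    volume (fullCoord e '' S) ≤ ENNReal.ofReal (4 * r ^ 2 * ∏ j, (2 * s j) ^ d j) := by
  have hsub : fullCoord e '' S ⊆
      Icc (fun o => o.elim (-ζ.re - r) fun o => o.elim (-ζ.im - r) fun c => -s c.1)
      (fun o => o.elim (-ζ.re + r) fun o => o.elim (-ζ.im + r) fun c => s c.1) := by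
    rintro _ ⟨w, hw, rfl⟩
    rw [mem_Icc, Pi.le_def, Pi.le_def, ← forall_and]
    rintro (_ | _ | ⟨j, i⟩)
    · have h1 := abs_le.1 ((Complex.abs_re_le_norm _).trans (hS w hw))
      rw [Complex.add_re] at h1
      simp only [fullCoord_none, Option.elim_none]
      constructor <;> linarith
    · have h1 := abs_le.1 ((Complex.abs_im_le_norm _).trans (hS w hw))
      rw [Complex.add_im] at h1
      simp only [fullCoord_some, graphCoord_none, Option.elim_none, Option.elim_some]
      constructor <;> linarith
    · rw [fullCoord_some, graphCoord_some]
      exact abs_le.1 ((PiLp.norm_apply_le _ i).trans (hS' w hw j))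
  refine (measure_mono hsub).trans (le_of_eq ?_)
  rw [Real.volume_Icc_pi, Fintype.prod_option]
  have : ∀ o : Option (Σ j : Fin k, Fin (d j)),
      ENNReal.ofReal (o.elim (-ζ.im + r) (fun c => s c.1) - o.elim (-ζ.im - r) fun c => -s c.1) =
      ENNReal.ofReal (2 * o.elim r fun c => s c.1) := by
    rintro (_ | c) <;> congr 1 <;> simp <;> ring
  simp only [Option.elim_none, Option.elim_some, this, prod_ofReal_graph hs hr]
  rw [← ENNReal.ofReal_mul (by linarith)]
  congr 1
  ring

end Coordinates

/-! ### The size of the blocks in a dyadic shell -/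

section Blocks

variable {m k : ℕ} {D : Set (EuclideanSpace ℂ (Fin (m + 1)))} {d : Fin k → ℕ}
  {e : (Σ j : Fin k, Fin (d j)) ≃ Fin m ⊕ Fin m} {f : Fin k → ℝ → ℝ} {δ : ℝ}

/-- `s j = f_j⁻¹ (Re ζ)`, where `ζ` is in the half disc of radius `δ / 2`. -/
structure IsInverseSystem (f : Fin k → ℝ → ℝ) (δ : ℝ) (ζ : ℂ) (s : Fin k → ℝ) : Prop where
  re_pos : 0 < ζ.re
  norm_lt : ‖ζ‖ < δ / 2
  pos : ∀ j, 0 < s j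
  map_eq : ∀ j, f j (s j) = ζ.re

/-- Serves the shells away from 0: there B A^i s_j exceeds the radius R₀ of a ball containing D,
with B independent of ζ. -/
theorem exists_uniform_range_le {A s₀ : ℝ} (hf : ∀ j, ProfileGrowth (f j) A s₀) (hA : 1 ≤ A)
    {R₀ : ℝ} (hR : 0 ≤ R₀) {c : ℝ} (hc : 0 < c) :
    ∃ B, 0 < B ∧ ∀ ζ s, IsInverseSystem f δ ζ s → ∀ i : ℕ, c ≤ 2 ^ i * ζ.re →
      ∀ j, R₀ ≤ B * A ^ i * s j := by
  choose B hB0 hB using fun j => (hf j).exists_range_le hR hc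
  obtain ⟨M, hM⟩ := (finite_range B).bddAbove
  refine ⟨max 1 M, by positivity, fun ζ s h i hi j => ?_⟩
  have hs := h.pos j
  have hBM : B j ≤ max 1 M := (hM (mem_range_self j)).trans (le_max_right _ _)
  calc R₀ ≤ B j * A ^ i * s j := hB j _ hs i (by rwa [h.map_eq j])
    _ ≤ _ := by gcongr

theorem norm_realBlock_le (w : EuclideanSpace ℂ (Fin (m + 1))) (j : Fin k) :
    ‖realBlock e (tangentialPart w) j‖ ≤ ‖w‖ := by
  have hinj : Function.Injective fun i : Fin (d j) => e ⟨j, i⟩ := fun a b hab => by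
    simpa using e.injective hab
  rw [← sq_le_sq₀ (norm_nonneg _) (norm_nonneg _), EuclideanSpace.norm_sq_eq,
    EuclideanSpace.norm_sq_eq, Fin.sum_univ_castSucc]
  calc ∑ i, ‖realBlock e (tangentialPart w) j i‖ ^ 2
      = ∑ i : Fin (d j), (realCoord (tangentialPart w) (e ⟨j, i⟩)) ^ 2 := by
        simp [realBlock]
    _ ≤ ∑ c : Fin m ⊕ Fin m, (realCoord (tangentialPart w) c) ^ 2 :=
        (Finset.sum_map Finset.univ ⟨_, hinj⟩ fun c => realCoord (tangentialPart w) c ^ 2).symm.le.trans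
          (Finset.sum_le_sum_of_subset_of_nonneg (Finset.subset_univ _)
            fun _ _ _ => sq_nonneg _)
    _ = ∑ i : Fin m, ‖w i.castSucc‖ ^ 2 := by
        rw [Fintype.sum_sum_type, ← Finset.sum_add_distrib]
        refine Finset.sum_congr rfl fun i _ => ?_
        rw [Complex.sq_norm, Complex.normSq_apply]
        simp [realCoord, tangentialPart, sq]
    _ ≤ _ := by linarith [sq_nonneg ‖w (Fin.last m)‖]

theorem re_nonneg_of_mem_closure (hD : IsExtendedDecoupledNearZero D e f δ)
    {w : EuclideanSpace ℂ (Fin (m + 1))} (hw : w ∈ closure D) : 0 ≤ (w (Fin.last m)).re := by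
  have hcl : IsClosed {w : EuclideanSpace ℂ (Fin (m + 1)) | 0 ≤ (w (Fin.last m)).re} :=
    isClosed_le continuous_const (Complex.continuous_re.comp (PiLp.continuous_apply 2 _ _))
  exact closure_minimal (fun w hw => (hD.subset_half w hw).le) hcl hw

theorem re_add_re_le_norm (w : EuclideanSpace ℂ (Fin (m + 1))) (ζ : ℂ) :
    (w (Fin.last m)).re + ζ.re ≤ ‖w (Fin.last m) + ζ‖ :=
  Complex.re_le_norm (w (Fin.last m) + ζ)

/-- In U, f_j(|s^j|) ≤ F < Re w_n < 2^i Re ζ = 2^i f_j(s_j), and the growth of f_j inverts this.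
Outside U the boundedness of D suffices. -/
theorem exists_norm_realBlock_le (hD : IsExtendedDecoupledNearZero D e f δ) {A s₀ : ℝ}
    (hf : ∀ j, ProfileGrowth (f j) A s₀) (hA : 1 ≤ A) (hs₀ : 0 < s₀) {R₀ : ℝ} (hR : 0 ≤ R₀)
    (hDR : D ⊆ Metric.closedBall 0 R₀) :
    ∃ B, 0 < B ∧ ∀ ζ s, IsInverseSystem f δ ζ s → ∀ w ∈ closure D, ∀ i : ℕ,
      ‖w (Fin.last m) + ζ‖ < 2 ^ i * ζ.re →
        ∀ j, ‖realBlock e (tangentialPart w) j‖ ≤ B * A ^ i * s j := by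
  obtain ⟨U, -, hU1, hU2⟩ := hD.exists_nhd
  have hδ := hD.delta_pos
  obtain ⟨B, hB0, hB⟩ := exists_uniform_range_le (δ := δ) hf hA hR (half_pos hδ)
  refine ⟨max B (max 1 (R₀ / s₀)), by positivity, fun ζ s hs w hw i hwi j => ?_⟩
  have hsj := hs.pos j
  have hDcase : ∀ w ∈ D, ‖w (Fin.last m) + ζ‖ < 2 ^ i * ζ.re →
      ‖realBlock e (tangentialPart w) j‖ ≤ max B (max 1 (R₀ / s₀)) * A ^ i * s j := by
    intro w hw hwi
    have hwR : ‖realBlock e (tangentialPart w) j‖ ≤ R₀ :=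
      (norm_realBlock_le w j).trans (by simpa using hDR hw)
    by_cases hwU : w ∈ U
    · have h1 : decoupledSum e f (tangentialPart w) < (w (Fin.last m)).re :=
        ((Set.ext_iff.1 hU1 w).1 ⟨hw, hwU⟩).2
      have h2 : f j ‖realBlock e (tangentialPart w) j‖ ≤ decoupledSum e f (tangentialPart w) :=
        Finset.single_le_sum (f := fun j => f j ‖realBlock e (tangentialPart w) j‖)
          (fun j _ => (hf j).nonneg (norm_nonneg _)) (Finset.mem_univ j)
      have h3 := re_add_re_le_norm w ζ
      have h4 := hs.re_pos
      refine ((hf j).le_of_lt (B := max 1 (R₀ / s₀)) (le_max_left _ _) ?_ hsj (norm_nonneg _) hwR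
        (i := i) ?_).trans ?_
      · rw [← div_le_iff₀ hs₀]; exact le_max_right _ _
      · rw [hs.map_eq]; linarith
      · have h5 := le_max_right B (max 1 (R₀ / s₀))
        gcongr
    -- Since |w_n| > δ and |ζ| < δ/2, the shell has 2^i Re ζ > δ/2.
    · have h1 : δ < ‖w (Fin.last m)‖ := (hU2 ⟨hw, hwU⟩).2
      have h2 := norm_sub_le (w (Fin.last m) + ζ) ζ
      rw [add_sub_cancel_right] at h2
      have h3 := hs.norm_lt
      refine hwR.trans ((hB ζ s hs i (by linarith) j).trans ?_)
      gcongr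
      exact le_max_left _ _
  have hcont : Continuous fun w : EuclideanSpace ℂ (Fin (m + 1)) =>
      ‖realBlock e (tangentialPart w) j‖ := by
    refine continuous_norm.comp ((PiLp.continuous_toLp 2 _).comp (continuous_pi fun i => ?_))
    exact (continuous_apply (some ⟨j, i⟩)).comp (graphCoord e).continuous
  have hopen : IsOpen {w : EuclideanSpace ℂ (Fin (m + 1)) | ‖w (Fin.last m) + ζ‖ < 2 ^ i * ζ.re ∧
      max B (max 1 (R₀ / s₀)) * A ^ i * s j < ‖realBlock e (tangentialPart w) j‖} :=
    (isOpen_lt (((PiLp.continuous_apply 2 _ _).add continuous_const).norm) continuous_const).and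
      (isOpen_lt continuous_const hcont)
  -- A violation at a point of the closure is an open condition, so it would occur in D.
  by_contra hlt
  obtain ⟨w', ⟨h1, h2⟩, hw'⟩ := mem_closure_iff.1 hw _ hopen ⟨hwi, not_le.1 hlt⟩
  exact absurd (hDcase w' hw' h1) (not_le.2 h2)

theorem prod_mul_pow (a b : ℝ) (i : ℕ) (s : Fin k → ℝ) :
    ∏ j, (2 * (a * b ^ i * s j)) ^ d j =
      (2 * a) ^ (∑ j, d j) * ((b ^ (∑ j, d j)) ^ i * ∏ j, s j ^ d j) := by
  simp only [mul_pow, Finset.prod_mul_distrib, ← Finset.prod_pow_eq_pow_sum, ← pow_mul,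
    mul_comm i]
  simp only [pow_mul, Finset.prod_pow]
  ring

/-! ### The measure of a dyadic shell -/

theorem exists_volume_shell_le (hD : IsExtendedDecoupledNearZero D e f δ) {A s₀ : ℝ}
    (hf : ∀ j, ProfileGrowth (f j) A s₀) (hA : 1 ≤ A) (hs₀ : 0 < s₀) {R₀ : ℝ} (hR : 0 ≤ R₀)
    (hDR : D ⊆ Metric.closedBall 0 R₀) :
    ∃ M, 0 ≤ M ∧ ∀ ζ s, IsInverseSystem f δ ζ s → ∀ i : ℕ,
      volume {w ∈ D | ‖w (Fin.last m) + ζ‖ < 2 ^ i * ζ.re} ≤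
        ENNReal.ofReal (M * (2 ^ i * ζ.re) ^ 2 *
          ((A ^ (∑ j, d j)) ^ i * ∏ j, s j ^ d j)) := by
  obtain ⟨B, hB0, hB⟩ := exists_norm_realBlock_le hD hf hA hs₀ hR hDR
  obtain ⟨L, hL⟩ := exists_norm_le_fullCoord e
  set c : NNReal := (volume : Measure (EuclideanSpace ℝ (Fin (2 * (m + 1))))).addHaarScalarFactor
    μH[(2 * (m + 1) : ℕ)] * L ^ (2 * (m + 1)) with hc
  refine ⟨c * (4 * (2 * B) ^ (∑ j, d j)), by positivity, fun ζ s hs i => ?_⟩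
  have ht := hs.re_pos
  rw [volume_eq_euclideanHausdorffMeasure]
  refine (euclideanHausdorffMeasure_le_image (card_option_option_sigma e) (Q := fullCoord e)
    (L := L) fun x _ y _ => hL _).trans ?_
  rw [← hc, mul_assoc, mul_assoc, ENNReal.ofReal_mul (by positivity), ENNReal.ofReal_coe_nnreal]
  gcongr
  refine (volume_fullCoord_image_le (ζ := ζ) (r := 2 ^ i * ζ.re) (s := fun j => B * A ^ i * s j)
    (by positivity) (fun j => ?_) (fun w hw => hw.2.le)
    fun w hw => hB ζ s hs w (subset_closure hw.1) i hw.2).trans (le_of_eq ?_)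
  · have := (hs.pos j).le
    positivity
  · rw [prod_mul_pow]
    congr 1
    ring

/-- Any v with ℓ v < 0 points from p into D, hence has positive last real part. If ℓ vanished on
`normalVec`, subtracting the normal component of v would keep ℓ v < 0 and make that real part zero.
-/
theorem fderiv_normalVec_ne_zero (hhalf : ∀ z ∈ D, 0 < (z (Fin.last m)).re)
    {p : EuclideanSpace ℂ (Fin (m + 1))} (hp : p ∈ frontier D) (hp0 : (p (Fin.last m)).re = 0)
    {V : Set (EuclideanSpace ℂ (Fin (m + 1)))} (hV : V ∈ 𝓝 p)
    {ρ : EuclideanSpace ℂ (Fin (m + 1)) → ℝ} {ℓ : EuclideanSpace ℂ (Fin (m + 1)) →L[ℝ] ℝ}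
    (hρ : HasFDerivAt ρ ℓ p) (hℓ : ℓ ≠ 0) (hDV : D ∩ V = {z ∈ V | ρ z < 0}) :
    ℓ (normalVec m) ≠ 0 := by
  have hpV := mem_of_mem_nhds hV
  have hρp : ρ p ≤ 0 := by
    by_contra hpos
    have hev : ∀ᶠ z in 𝓝 p, z ∈ V ∧ 0 < ρ z :=
      (Filter.Eventually.and hV (hρ.continuousAt.eventually (lt_mem_nhds (not_le.1 hpos))))
    obtain ⟨z, ⟨hzV, hz⟩, hzD⟩ := mem_closure_iff_nhds.1 hp.1 _ hev
    have := ((Set.ext_iff.1 hDV z).1 ⟨hzD, hzV⟩).2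
    linarith
  have key : ∀ v, ℓ v < 0 → 0 < (v (Fin.last m)).re := by
    intro v hv
    have hg : HasDerivAt (fun τ : ℝ => ρ (p + τ • v)) (ℓ v) 0 := by
      have h1 : HasDerivAt (fun τ : ℝ => p + τ • v) v 0 := by
        simpa using ((hasDerivAt_id (0 : ℝ)).smul_const v).const_add p
      have h2 : HasFDerivAt ρ ℓ (p + (0 : ℝ) • v) := by simpa using hρ
      exact h2.comp_hasDerivAt (0 : ℝ) h1
    have hev : ∀ᶠ τ in 𝓝[>] (0 : ℝ), ρ (p + τ • v) < 0 := by
      have := hg.tendsto_slope_zero_right.eventually (gt_mem_nhds hv)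
      filter_upwards [this, self_mem_nhdsWithin] with τ hτ hτ0
      have hτ0' : (0 : ℝ) < τ := hτ0
      simp only [zero_add, zero_smul, add_zero, smul_eq_mul] at hτ
      have := neg_of_mul_neg_right hτ (by positivity)
      linarith
    have hevV : ∀ᶠ τ in 𝓝[>] (0 : ℝ), p + τ • v ∈ V := by
      have : Tendsto (fun τ : ℝ => p + τ • v) (𝓝 0) (𝓝 p) := by
        have : ContinuousAt (fun τ : ℝ => p + τ • v) 0 := by fun_prop
        simpa [ContinuousAt] using this
      exact (this.eventually hV).filter_mono nhdsWithin_le_nhds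
    obtain ⟨τ, ⟨h1, h2⟩, h3⟩ := ((hev.and hevV).and self_mem_nhdsWithin).exists
    have hτ : (0 : ℝ) < τ := h3
    have := hhalf _ ((Set.ext_iff.1 hDV _).2 ⟨h2, h1⟩).1
    simp only [PiLp.add_apply, PiLp.smul_apply, Complex.add_re, hp0, Complex.real_smul,
      Complex.re_ofReal_mul, zero_add] at this
    exact pos_of_mul_pos_right this hτ.le
  intro h0
  obtain ⟨v, hv⟩ : ∃ v, ℓ v < 0 := by
    obtain ⟨v, hv⟩ : ∃ v, ℓ v ≠ 0 := by
      by_contra! hall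
      exact hℓ (ContinuousLinearMap.ext hall)
    rcases lt_or_gt_of_ne hv with h | h
    · exact ⟨v, h⟩
    · exact ⟨-v, by simpa using h⟩
  have := key (v - (v (Fin.last m)).re • normalVec m) (by simpa [h0] using hv)
  simp [normalVec] at this

end Blocks

/-! ### The surface measure of a dyadic shell -/

section Surface

variable {m k : ℕ} {D : Set (EuclideanSpace ℂ (Fin (m + 1)))} {d : Fin k → ℕ}
  {e : (Σ j : Fin k, Fin (d j)) ≃ Fin m ⊕ Fin m} {f : Fin k → ℝ → ℝ} {δ : ℝ}

theorem frontier_innerDomain_subset {n : ℕ} (D : Set (EuclideanSpace ℂ (Fin n))) (ε : ℝ) :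
    frontier (innerDomain D ε) ⊆ closure D :=
  frontier_subset_closure.trans (closure_mono fun _ h => h.1)

theorem innerDomain_zero {n : ℕ} {D : Set (EuclideanSpace ℂ (Fin n))} (hD : IsOpen D)
    (hne : (frontier D).Nonempty) : innerDomain D 0 = D := by
  refine Subset.antisymm (fun z hz => hz.1) fun z hz => ⟨hz, ?_⟩
  refine lt_of_le_of_ne Metric.infDist_nonneg fun h => ?_
  have : z ∈ frontier D := (isClosed_frontier.mem_iff_infDist_zero hne).2 h.symm
  exact (disjoint_frontier_iff_isOpen.2 hD).le_bot ⟨this, hz⟩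

theorem infDist_le_of_mem_frontier_innerDomain {n : ℕ} {D : Set (EuclideanSpace ℂ (Fin n))}
    (hD : IsOpen D) {ε : ℝ} (hε : 0 ≤ ε)
    {x : EuclideanSpace ℂ (Fin n)} (hx : x ∈ frontier (innerDomain D ε)) :
    Metric.infDist x (frontier D) ≤ ε := by
  by_contra! hlt
  have hxf : x ∉ frontier D := fun h => by
    rw [Metric.infDist_zero_of_mem h] at hlt
    linarith
  have hxD : x ∈ D := by
    by_contra hxD
    exact hxf ⟨frontier_innerDomain_subset D ε hx, by rwa [hD.interior_eq]⟩
  exact (disjoint_frontier_iff_isOpen.2 (isOpen_setOf_lt_infDist hD ε)).le_bot ⟨hx, hxD, hlt⟩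

/-- If Re p_n = 0, the frontiers near p are uniform graphs in the direction `normalVec` and the box
estimate applies. If Re p_n > 0, shells with small 2^i Re ζ do not meet the ball and the others need
only a constant bound. -/
theorem exists_surface_shell_le_near (hD : IsExtendedDecoupledNearZero D e f δ)
    (hDopen : IsOpen D) (hC2 : HasC2Boundary D) {A s₀ : ℝ}
    (hf : ∀ j, ProfileGrowth (f j) A s₀) (hA : 1 ≤ A) (hs₀ : 0 < s₀) {R₀ : ℝ} (hR : 0 < R₀)
    (hDR : D ⊆ Metric.closedBall 0 R₀) {p : EuclideanSpace ℂ (Fin (m + 1))}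
    (hp : p ∈ frontier D) :
    ∃ r > 0, ∃ M, 0 ≤ M ∧ ∀ ε, 0 ≤ ε → ε < r → ∀ ζ s, IsInverseSystem f δ ζ s → ∀ i : ℕ,
      (μHE[2 * (m + 1) - 1] : Measure (EuclideanSpace ℂ (Fin (m + 1))))
        ((frontier (innerDomain D ε) ∩ Metric.ball p r) ∩
          {w | ‖w (Fin.last m) + ζ‖ < 2 ^ i * ζ.re}) ≤
        ENNReal.ofReal (M * (2 ^ i * ζ.re) ^ 1 *
          ((A ^ (∑ j, d j)) ^ i * ∏ j, s j ^ d j)) := by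
  obtain ⟨V, ρ, hVo, hpV, hρ, hρ', hDV⟩ := hC2 p hp
  have hVn : V ∈ 𝓝 p := hVo.mem_nhds hpV
  have hstrict : HasStrictFDerivAt ρ (fderiv ℝ ρ p) p :=
    (hρ.contDiffAt hVn).hasStrictFDerivAt (by norm_num)
  set ℓ := fderiv ℝ ρ p with hℓ
  have hℓ0 : ℓ ≠ 0 := hρ' p hpV
  obtain ⟨C, hC⟩ := exists_norm_sub_le_graphCoord e
  set c₀ : NNReal := (volume : Measure
    (EuclideanSpace ℝ (Fin (2 * (m + 1) - 1)))).addHaarScalarFactor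
    μH[(2 * (m + 1) - 1 : ℕ)] with hc₀
  rcases (re_nonneg_of_mem_closure hD hp.1).eq_or_lt with hp0 | hp0
  · have hb := fderiv_normalVec_ne_zero hD.subset_half hp hp0.symm hVn hstrict.hasFDerivAt hℓ0 hDV
    obtain ⟨a, ha, L, hL⟩ := exists_norm_le_of_abs_le hC ℓ hb
    obtain ⟨r, hr, hcone⟩ := exists_abs_fderiv_sub_le hDopen hp hVn hstrict hDV ha
    obtain ⟨B, hB0, hB⟩ := exists_norm_realBlock_le hD hf hA hs₀ hR.le hDR
    refine ⟨r, hr, (c₀ * L ^ (2 * (m + 1) - 1) : NNReal) * (2 * (2 * B) ^ (∑ j, d j)),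
      by positivity, fun ε hε hεr ζ s hs i => ?_⟩
    have ht := hs.re_pos
    refine (euclideanHausdorffMeasure_le_image (card_option_sigma e) (Q := graphCoord e)
      (L := L) fun x hx y hy => hL _ (hcone ε hε hεr x hx.1 y hy.1)).trans ?_
    rw [← hc₀, mul_assoc, mul_assoc, ENNReal.ofReal_mul (by positivity), ENNReal.ofReal_coe_nnreal]
    gcongr
    refine (volume_graphCoord_image_le (ζ := ζ) (r := 2 ^ i * ζ.re) (s := fun j => B * A ^ i * s j)
      (by positivity) (fun j => ?_) (fun w hw => le_of_lt hw.2)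
      fun w hw => hB ζ s hs w (frontier_innerDomain_subset D ε hw.1.1) i hw.2).trans (le_of_eq ?_)
    · have := (hs.pos j).le
      positivity
    · rw [prod_mul_pow]
      congr 1
      ring
  · obtain ⟨b, hb⟩ : ∃ b, ℓ b ≠ 0 := by
      by_contra! hall
      exact hℓ0 (ContinuousLinearMap.ext hall)
    have hb0 : b ≠ 0 := fun h => hb (by simp [h])
    have hn0 : normalVec m ≠ 0 := by simp [normalVec]
    -- Θ carries the transversal direction b to `normalVec`, so `graphCoord` after Θ serves as
    -- projection along b.
    obtain ⟨Θ, hΘ⟩ := SeparatingDual.exists_continuousLinearEquiv_apply_eq (R := ℝ) hb0 hn0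
    set Q : EuclideanSpace ℂ (Fin (m + 1)) →L[ℝ] (Option (Σ j : Fin k, Fin (d j)) → ℝ) :=
      (graphCoord e).comp Θ.toContinuousLinearMap with hQ
    have hC' : ∀ v, ‖v - ((Θ v) (Fin.last m)).re • b‖ ≤
        ‖Θ.symm.toContinuousLinearMap‖ * C * ‖Q v‖ := by
      intro v
      have e1 : v - ((Θ v) (Fin.last m)).re • b =
          Θ.symm.toContinuousLinearMap
            (Θ v - ((Θ v) (Fin.last m)).re • normalVec m) := by
        simp [← hΘ]
      rw [e1, mul_assoc]
      exact (ContinuousLinearMap.le_opNorm _ _).trans (by gcongr; exact hC (Θ v))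
    obtain ⟨a, ha, L, hL⟩ := exists_norm_le_of_abs_le hC' ℓ hb
    obtain ⟨r, hr, hcone⟩ := exists_abs_fderiv_sub_le hDopen hp hVn hstrict hDV ha
    set c := (p (Fin.last m)).re / 2 with hc
    have hc0 : 0 < c := half_pos hp0
    obtain ⟨B, hB0, hB⟩ := exists_uniform_range_le (δ := δ) hf hA hR.le hc0
    have hfin : volume (Q '' Metric.closedBall 0 R₀) < ⊤ :=
      (Q.lipschitz.isBounded_image Metric.isBounded_closedBall).measure_lt_top
    set M₀ : ℝ := (volume (Q '' Metric.closedBall 0 R₀)).toReal with hM₀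
    -- When c ≤ 2^i Re ζ, the factors c⁻¹ (2^i Re ζ) and (B/R₀)^(∑ d_j) G^i ∏ s_j^(d_j) with G =
    -- A^(∑ d_j) are at least 1, so the constant volume M₀ may be multiplied by them.
    refine ⟨min r c, lt_min hr hc0, (c₀ * L ^ (2 * (m + 1) - 1) : NNReal) *
      (M₀ * (c⁻¹ * (B / R₀) ^ (∑ j, d j))), by positivity, fun ε hε hεr ζ s hs i => ?_⟩
    have ht := hs.re_pos
    by_cases hic : c ≤ 2 ^ i * ζ.re
    · refine (euclideanHausdorffMeasure_le_image (card_option_sigma e) (Q := Q)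
        (L := L) fun x hx y hy => hL _ (hcone ε hε (hεr.trans_le (min_le_left _ _))
          x ⟨hx.1.1, Metric.ball_subset_ball (min_le_left _ _) hx.1.2⟩
          y ⟨hy.1.1, Metric.ball_subset_ball (min_le_left _ _) hy.1.2⟩)).trans ?_
      rw [← hc₀, mul_assoc, mul_assoc, ENNReal.ofReal_mul (by positivity),
        ENNReal.ofReal_coe_nnreal]
      gcongr
      have hsub : Q '' ((frontier (innerDomain D ε) ∩ Metric.ball p (min r c)) ∩
          {w | ‖w (Fin.last m) + ζ‖ < 2 ^ i * ζ.re}) ⊆ Q '' Metric.closedBall 0 R₀ :=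
        image_mono fun w hw => closure_minimal hDR Metric.isClosed_closedBall
          (frontier_innerDomain_subset D ε hw.1.1)
      refine (measure_mono hsub).trans ?_
      rw [← ENNReal.ofReal_toReal hfin.ne, ← hM₀]
      apply ENNReal.ofReal_le_ofReal
      have h1 : 1 ≤ c⁻¹ * (2 ^ i * ζ.re) := by
        rw [inv_mul_eq_div, one_le_div hc0]; exact hic
      have h2 : 1 ≤ (B / R₀) ^ (∑ j, d j) * ((A ^ (∑ j, d j)) ^ i * ∏ j, s j ^ d j) := by
        have e1 : (B / R₀) ^ (∑ j, d j) * ((A ^ (∑ j, d j)) ^ i * ∏ j, s j ^ d j) =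
            ∏ j, (B * A ^ i * s j / R₀) ^ d j := by
          have := prod_mul_pow (d := d) (B / R₀ / 2) A i s
          rw [mul_div_cancel₀ _ two_ne_zero] at this
          rw [← this]
          refine Finset.prod_congr rfl fun j _ => ?_
          congr 1
          ring
        rw [e1]
        rw [← Finset.prod_const_one (s := Finset.univ (α := Fin k))]
        refine Finset.prod_le_prod (fun _ _ => zero_le_one) fun j _ => one_le_pow₀ ?_
        rw [one_le_div hR]
        exact hB ζ s hs i hic j
      have h3 := one_le_mul_of_one_le_of_one_le h1 h2
      exact (le_mul_of_one_le_right ENNReal.toReal_nonneg h3).trans (le_of_eq (by ring))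
    · have hempty : (frontier (innerDomain D ε) ∩ Metric.ball p (min r c)) ∩
          {w | ‖w (Fin.last m) + ζ‖ < 2 ^ i * ζ.re} = ∅ := by
        refine eq_empty_of_forall_notMem fun w hw => hic ?_
        have h1 : dist w p < c := (Metric.mem_ball.1 hw.1.2).trans_le (min_le_right _ _)
        have h2 : |(w (Fin.last m)).re - (p (Fin.last m)).re| ≤ dist w p := by
          rw [dist_eq_norm, ← Complex.sub_re]
          exact (Complex.abs_re_le_norm _).trans (PiLp.norm_apply_le (w - p) (Fin.last m))
        have h3 := re_add_re_le_norm w ζ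
        have h4 : ‖w (Fin.last m) + ζ‖ < 2 ^ i * ζ.re := hw.2
        have h5 := (abs_le.1 h2).1
        linarith
      rw [hempty, measure_empty]
      exact zero_le

/-- Compactness of the frontier gives a finite cover by the local balls; for small ε the frontier of
the inner domain lies in a thin thickening that they still cover. -/
theorem exists_surface_shell_le (hD : IsExtendedDecoupledNearZero D e f δ)
    (hDopen : IsOpen D) (hC2 : HasC2Boundary D) (hne : (frontier D).Nonempty) {A s₀ : ℝ}
    (hf : ∀ j, ProfileGrowth (f j) A s₀) (hA : 1 ≤ A) (hs₀ : 0 < s₀) {R₀ : ℝ} (hR : 0 < R₀)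
    (hDR : D ⊆ Metric.closedBall 0 R₀) :
    ∃ ε₀ > 0, ∃ M, 0 ≤ M ∧ ∀ ε, 0 ≤ ε → ε < ε₀ → ∀ ζ s, IsInverseSystem f δ ζ s → ∀ i : ℕ,
      surfaceMeasure (frontier (innerDomain D ε)) {w | ‖w (Fin.last m) + ζ‖ < 2 ^ i * ζ.re} ≤
        ENNReal.ofReal (M * (2 ^ i * ζ.re) ^ 1 *
          ((A ^ (∑ j, d j)) ^ i * ∏ j, s j ^ d j)) := by
  have hcomp : IsCompact (frontier D) :=
    Metric.isCompact_of_isClosed_isBounded isClosed_frontier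
      (Metric.isBounded_closedBall.subset
        (frontier_subset_closure.trans (closure_minimal hDR Metric.isClosed_closedBall)))
  choose! r hr M hM hmain using fun p hp =>
    exists_surface_shell_le_near (p := p) hD hDopen hC2 hf hA hs₀ hR hDR hp
  obtain ⟨T, hTD, hT⟩ := hcomp.elim_nhds_subcover (fun p => Metric.ball p (r p))
    fun p hp => Metric.ball_mem_nhds p (hr p hp)
  obtain ⟨η, hη, hηsub⟩ := hcomp.exists_thickening_subset_open
    (isOpen_biUnion fun p _ => Metric.isOpen_ball) hT
  have hTne : T.Nonempty := by
    by_contra hTe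
    obtain ⟨p, hp⟩ := hne
    simpa [Finset.not_nonempty_iff_eq_empty.1 hTe] using hT hp
  obtain ⟨q, hqT, hq⟩ := T.exists_min_image r hTne
  refine ⟨min η (r q), lt_min hη (hr q (hTD q hqT)), ∑ p ∈ T, M p,
    Finset.sum_nonneg fun p hp => hM p (hTD p hp), fun ε hε hε₀ ζ s hs i => ?_⟩
  obtain ⟨hεη, hεq⟩ := lt_min_iff.1 hε₀
  have ht := hs.re_pos
  have hprod : 0 ≤ ∏ j, s j ^ d j := Finset.prod_nonneg fun j _ => pow_nonneg (hs.pos j).le _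
  have hopen : IsOpen {w : EuclideanSpace ℂ (Fin (m + 1)) |
      ‖w (Fin.last m) + ζ‖ < 2 ^ i * ζ.re} :=
    isOpen_lt (((PiLp.continuous_apply 2 _ _).add continuous_const).norm) continuous_const
  rw [surfaceMeasure, Measure.restrict_apply hopen.measurableSet]
  have hsub : {w : EuclideanSpace ℂ (Fin (m + 1)) | ‖w (Fin.last m) + ζ‖ < 2 ^ i * ζ.re} ∩
      frontier (innerDomain D ε) ⊆
      ⋃ p ∈ T, (frontier (innerDomain D ε) ∩ Metric.ball p (r p)) ∩
          {w | ‖w (Fin.last m) + ζ‖ < 2 ^ i * ζ.re} := by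
    rintro w ⟨hw, hwf⟩
    have hwη : w ∈ Metric.thickening η (frontier D) := by
      rw [Metric.mem_thickening_iff_infDist_lt hne]
      exact (infDist_le_of_mem_frontier_innerDomain hDopen hε hwf).trans_lt hεη
    obtain ⟨p, hpT, hwp⟩ := mem_iUnion₂.1 (hηsub hwη)
    exact mem_iUnion₂.2 ⟨p, hpT, ⟨hwf, hwp⟩, hw⟩
  refine (measure_mono hsub).trans ((measure_biUnion_finset_le T _).trans ?_)
  rw [Finset.sum_mul, Finset.sum_mul, ENNReal.ofReal_sum_of_nonneg]
  · exact Finset.sum_le_sum fun p hp =>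
      hmain p (hTD p hp) ε hε (hεq.trans_le (hq p hp)) ζ s hs i
  · intro p hp
    have := hM p (hTD p hp)
    positivity

end Surface

/-! ### Reproducing kernels and extremal values -/

/-- Cauchy–Schwarz, with ‖g‖² written as the integral that the reproducing property turns into the
kernel on the diagonal. -/
theorem sq_norm_integral_mul_le {α : Type*} [MeasurableSpace α] {μ : Measure α} {f g : α → ℂ}
    (hg : MemLp g 2 μ) (hf : AEStronglyMeasurable f μ) {M : ℝ} (hM : 0 ≤ M)
    (hfM : ∫⁻ w, ‖f w‖ₑ ^ 2 ∂μ ≤ ENNReal.ofReal M) :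
    ‖∫ w, f w * g w ∂μ‖ ^ 2 ≤ M * (∫ w, star (g w) * g w ∂μ).re := by
  have hsq : ∀ w, star (g w) * g w = ((‖g w‖ ^ 2 : ℝ) : ℂ) := fun w => by
    rw [Complex.star_def, Complex.conj_mul']
    norm_cast
  have hint : Integrable (fun w => ‖g w‖ ^ 2) μ := hg.integrable_norm_pow two_ne_zero
  have hY : ∫⁻ w, ‖g w‖ₑ ^ 2 ∂μ = ENNReal.ofReal (∫ w, star (g w) * g w ∂μ).re := by
    simp_rw [hsq]
    rw [integral_complex_ofReal, Complex.ofReal_re,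
      ofReal_integral_eq_lintegral_ofReal hint (ae_of_all _ fun w => by positivity)]
    refine lintegral_congr fun w => ?_
    rw [ENNReal.ofReal_pow (norm_nonneg _), ofReal_norm]
  set κ := (∫ w, star (g w) * g w ∂μ).re with hκ
  have hκ0 : 0 ≤ κ := by
    rw [hκ]
    simp_rw [hsq]
    rw [integral_complex_ofReal, Complex.ofReal_re]
    positivity
  have h1 : ‖∫ w, f w * g w ∂μ‖ₑ ≤
      (∫⁻ w, ‖f w‖ₑ ^ (2 : ℝ) ∂μ) ^ (1 / 2 : ℝ) * (∫⁻ w, ‖g w‖ₑ ^ (2 : ℝ) ∂μ) ^ (1 / 2 : ℝ) := by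
    refine (enorm_integral_le_lintegral_enorm _).trans ?_
    simp_rw [enorm_mul]
    exact ENNReal.lintegral_mul_le_Lp_mul_Lq μ Real.HolderConjugate.two_two hf.enorm hg.1.enorm
  simp only [ENNReal.rpow_two, hY] at h1
  have h2 : ‖∫ w, f w * g w ∂μ‖ₑ ^ 2 ≤ ENNReal.ofReal (M * κ) := by
    calc ‖∫ w, f w * g w ∂μ‖ₑ ^ 2 ≤ _ := pow_le_pow_left₀ zero_le h1 2
      _ = (∫⁻ w, ‖f w‖ₑ ^ 2 ∂μ) * ENNReal.ofReal κ := by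
        rw [mul_pow, ← ENNReal.rpow_mul_natCast, ← ENNReal.rpow_mul_natCast]
        norm_num
      _ ≤ _ := by
        rw [ENNReal.ofReal_mul hM]
        gcongr
  rw [← ofReal_norm, ← ENNReal.ofReal_pow (norm_nonneg _)] at h2
  exact (ENNReal.ofReal_le_ofReal_iff (by positivity)).1 h2

section Kernels

variable {n : ℕ} {D : Set (EuclideanSpace ℂ (Fin n))} {z : EuclideanSpace ℂ (Fin n)}
  {h : EuclideanSpace ℂ (Fin n) → ℂ} {M c : ℝ}

theorem sq_norm_le_of_isBergmanKernel (hD : IsOpen D)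
    {K : EuclideanSpace ℂ (Fin n) → EuclideanSpace ℂ (Fin n) → ℂ} (hK : IsBergmanKernel D K)
    (hz : z ∈ D) (hh : MemBergman D h) (hM : 0 ≤ M)
    (hhM : ∫⁻ w in D, ‖h w‖ₑ ^ 2 ≤ ENNReal.ofReal M) : ‖h z‖ ^ 2 ≤ M * (K z z).re := by
  have hKz : MemLp (K z) 2 (volume.restrict D) := by
    refine (memLp_congr_ae ?_).1 (hK.mem z hz).2.star
    filter_upwards [ae_restrict_mem hD.measurableSet] with w hw
    exact hK.conj_symm w hw z hz
  have h1 := sq_norm_integral_mul_le hKz hh.2.1 hM hhM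
  have h2 : h z = ∫ w in D, h w * K z w := by
    rw [hK.reproducing h hh z hz]
    exact integral_congr_ae (ae_of_all _ fun w => mul_comm _ _)
  have h3 : K z z = ∫ w in D, star (K z w) * K z w := by
    rw [hK.reproducing (fun w => K w z) (hK.mem z hz) z hz]
    refine setIntegral_congr_fun hD.measurableSet fun w hw => ?_
    simp only [hK.conj_symm z hz w hw, mul_comm]
  rwa [← h2, ← h3] at h1

/-- The reproducing property is used twice, for h and for S(·, z), whose boundary values are the
conjugates of S(z, ·). -/
theorem sq_norm_le_of_isSzegoKernel
    {S : EuclideanSpace ℂ (Fin n) → EuclideanSpace ℂ (Fin n) → ℂ} (hS : IsSzegoKernel D S)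
    (hz : z ∈ D) (hh : MemHardy D h) (hb : IsBoundaryValue D h h)
    (hmeas : AEStronglyMeasurable h (surfaceMeasure (frontier D))) (hM : 0 ≤ M)
    (hhM : ∫⁻ w, ‖h w‖ₑ ^ 2 ∂surfaceMeasure (frontier D) ≤ ENNReal.ofReal M) :
    ‖h z‖ ^ 2 ≤ M * (S z z).re := by
  have h1 := sq_norm_integral_mul_le (hS.boundary_memLp z hz) hmeas hM hhM
  have hbS : IsBoundaryValue D (fun w => S w z) fun ξ => star (S z ξ) := by
    filter_upwards [hS.boundary z hz] with ξ hξ α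
    refine ((hξ α).star).congr' ?_
    filter_upwards [self_mem_nhdsWithin] with w hw
    exact hS.conj_symm z hz w hw.1
  have h3 : S z z = ∫ ξ, star (S z ξ) * S z ξ ∂surfaceMeasure (frontier D) :=
    hS.reproducing (fun w => S w z) _ (hS.mem z hz) hbS z hz
  rwa [← hS.reproducing h h hh hb z hz, ← h3] at h1

theorem enorm_inv_sqrt_mul_sq (hM : 0 < M) (a : ℂ) :
    ‖((Real.sqrt M)⁻¹ : ℂ) * a‖ₑ ^ 2 = ENNReal.ofReal M⁻¹ * ‖a‖ₑ ^ 2 := by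
  rw [enorm_mul, mul_pow]
  congr 1
  rw [← ofReal_norm, ← ENNReal.ofReal_pow (norm_nonneg _), norm_inv, Complex.norm_real,
    Real.norm_eq_abs, inv_pow, sq_abs, Real.sq_sqrt hM.le]

theorem ofReal_le_enorm_inv_sqrt_mul_sq (hM : 0 < M) {a : ℂ} (hc : c * M ≤ ‖a‖ ^ 2) :
    ENNReal.ofReal c ≤ ‖((Real.sqrt M)⁻¹ : ℂ) * a‖ₑ ^ 2 := by
  rw [enorm_inv_sqrt_mul_sq hM, ← ofReal_norm, ← ENNReal.ofReal_pow (norm_nonneg _),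
    ← ENNReal.ofReal_mul (by positivity)]
  apply ENNReal.ofReal_le_ofReal
  rwa [inv_mul_eq_div, le_div_iff₀ hM]

theorem lintegral_inv_sqrt_mul_le {μ : Measure (EuclideanSpace ℂ (Fin n))} (hM : 0 < M)
    (hhM : ∫⁻ w, ‖h w‖ₑ ^ 2 ∂μ ≤ ENNReal.ofReal M) :
    ∫⁻ w, ‖((Real.sqrt M)⁻¹ : ℂ) * h w‖ₑ ^ 2 ∂μ ≤ 1 := by
  simp_rw [enorm_inv_sqrt_mul_sq hM]
  rw [lintegral_const_mul' _ _ ENNReal.ofReal_ne_top]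
  calc _ ≤ ENNReal.ofReal M⁻¹ * ENNReal.ofReal M := by gcongr
    _ = 1 := by rw [← ENNReal.ofReal_mul (by positivity), inv_mul_cancel₀ hM.ne', ENNReal.ofReal_one]

theorem ofReal_le_bergmanDiag (hh : MemBergman D h) (hM : 0 < M)
    (hhM : ∫⁻ w in D, ‖h w‖ₑ ^ 2 ≤ ENNReal.ofReal M) (hc : c * M ≤ ‖h z‖ ^ 2) :
    ENNReal.ofReal c ≤ bergmanDiag D z := by
  refine (ofReal_le_enorm_inv_sqrt_mul_sq hM hc).trans ?_
  exact le_iSup₂_of_le (fun w => ((Real.sqrt M)⁻¹ : ℂ) * h w)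
    ⟨hh.1.const_mul _, hh.2.const_mul _⟩
    (le_iSup_of_le (lintegral_inv_sqrt_mul_le hM hhM) le_rfl)

theorem hardyNormSq_le {C : ℝ≥0∞} (hhM : ∀ᶠ ε in 𝓝[>] (0 : ℝ),
      ∫⁻ w, ‖h w‖ₑ ^ 2 ∂surfaceMeasure (frontier (innerDomain D ε)) ≤ C) :
    hardyNormSq D h ≤ C :=
  limsup_le_of_le (by isBoundedDefault) hhM

theorem ofReal_le_szegoDiag (hh : DifferentiableOn ℂ h D) (hM : 0 < M)
    (hhM : ∀ᶠ ε in 𝓝[>] (0 : ℝ),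
      ∫⁻ w, ‖h w‖ₑ ^ 2 ∂surfaceMeasure (frontier (innerDomain D ε)) ≤ ENNReal.ofReal M)
    (hc : c * M ≤ ‖h z‖ ^ 2) : ENNReal.ofReal c ≤ szegoDiag D z := by
  refine (ofReal_le_enorm_inv_sqrt_mul_sq hM hc).trans ?_
  have hle : hardyNormSq D (fun w => ((Real.sqrt M)⁻¹ : ℂ) * h w) ≤ 1 :=
    hardyNormSq_le (hhM.mono fun ε hε => lintegral_inv_sqrt_mul_le hM hε)
  exact le_iSup₂_of_le (fun w => ((Real.sqrt M)⁻¹ : ℂ) * h w)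
    ⟨hh.const_mul _, hle.trans_lt ENNReal.one_lt_top⟩ (le_iSup_of_le hle le_rfl)

end Kernels

/-! ### The test functions -/

section Test

variable {m : ℕ} {D : Set (EuclideanSpace ℂ (Fin (m + 1)))} {ζ : ℂ} {N : ℕ}

/-- The test function `(w_{m+1} + ζ)^{-N}`. -/
noncomputable def testFun (ζ : ℂ) (N : ℕ) (w : EuclideanSpace ℂ (Fin (m + 1))) : ℂ :=
  ((w (Fin.last m) + ζ) ^ N)⁻¹

theorem enorm_testFun_sq (w : EuclideanSpace ℂ (Fin (m + 1))) :
    ‖testFun ζ N w‖ₑ ^ 2 = ENNReal.ofReal ((‖w (Fin.last m) + ζ‖ ^ (2 * N))⁻¹) := by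
  rw [← ofReal_norm, ← ENNReal.ofReal_pow (norm_nonneg _), testFun, norm_inv, norm_pow, inv_pow,
    ← pow_mul, mul_comm N]

theorem measurable_testFun :
    Measurable (testFun ζ N : EuclideanSpace ℂ (Fin (m + 1)) → ℂ) :=
  ((((PiLp.continuous_apply 2 _ _).add continuous_const).pow N).measurable).inv

theorem differentiableAt_testFun {w : EuclideanSpace ℂ (Fin (m + 1))}
    (hw : w (Fin.last m) + ζ ≠ 0) : DifferentiableAt ℂ (testFun ζ N) w := by
  have : DifferentiableAt ℂ (fun w : EuclideanSpace ℂ (Fin (m + 1)) => w (Fin.last m)) w :=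
    (EuclideanSpace.proj (Fin.last m) :
      EuclideanSpace ℂ (Fin (m + 1)) →L[ℂ] ℂ).differentiableAt
  exact ((this.add_const ζ).pow N).inv (pow_ne_zero N hw)

theorem norm_testFun_conj_sq (z : EuclideanSpace ℂ (Fin (m + 1))) :
    ‖testFun (star (z (Fin.last m))) N z‖ ^ 2 = ((2 * (z (Fin.last m)).re) ^ (2 * N))⁻¹ := by
  rw [testFun, Complex.star_def, Complex.add_conj, norm_inv, norm_pow, inv_pow, ← pow_mul,
    Complex.norm_real, mul_comm N, pow_mul, Real.norm_eq_abs, sq_abs, ← pow_mul]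

end Test

/-! ### The lower bound -/

section Main

variable {m k : ℕ} {D : Set (EuclideanSpace ℂ (Fin (m + 1)))} {d : Fin k → ℕ}
  {e : (Σ j : Fin k, Fin (d j)) ≃ Fin m ⊕ Fin m} {f : Fin k → ℝ → ℝ} {δ : ℝ}

theorem isInverseSystem_invFunOn {A s₀ : ℝ} (hf : ∀ j, ProfileGrowth (f j) A s₀) {ζ : ℂ}
    (hre : 0 < ζ.re) (hζ : ‖ζ‖ < δ / 2) (hrange : ∀ j, ζ.re ∈ f j '' Ici 0) :
    IsInverseSystem f δ ζ fun j => Function.invFunOn (f j) (Ici 0) ζ.re where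
  re_pos := hre
  norm_lt := hζ
  map_eq j := (Function.invFunOn_pos (hrange j)).2
  pos j := by
    obtain ⟨h1, h2⟩ := Function.invFunOn_pos (hrange j)
    refine lt_of_le_of_ne h1 fun h0 => ?_
    rw [← h0, (hf j).zero] at h2
    exact hre.ne h2

theorem re_pos_of_mem_closure (hD : IsExtendedDecoupledNearZero D e f δ) {ζ : ℂ} (hζ : 0 < ζ.re)
    {w : EuclideanSpace ℂ (Fin (m + 1))} (hw : w ∈ closure D) :
    ζ.re ≤ ‖w (Fin.last m) + ζ‖ ∧ w (Fin.last m) + ζ ≠ 0 := by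
  have h1 : ζ.re ≤ ‖w (Fin.last m) + ζ‖ := by
    linarith [re_add_re_le_norm w ζ, re_nonneg_of_mem_closure hD hw]
  exact ⟨h1, norm_pos_iff.1 (hζ.trans_le h1)⟩

theorem isBoundaryValue_testFun (hD : IsExtendedDecoupledNearZero D e f δ) {ζ : ℂ}
    (hζ : 0 < ζ.re) (N : ℕ) : IsBoundaryValue D (testFun ζ N) (testFun ζ N) := by
  filter_upwards [ae_restrict_mem isClosed_frontier.measurableSet] with ξ hξ α
  have hne := (re_pos_of_mem_closure hD hζ (frontier_subset_closure hξ)).2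
  exact (differentiableAt_testFun hne).continuousAt.tendsto.mono_left nhdsWithin_le_nhds

/-- The powers of t and the product over blocks cancel. An inequality for c lets one constant serve
both q = 1 and q = 2. -/
theorem mul_inverseProduct_mul_le {t c G M : ℝ} {q N : ℕ} (ht : 0 < t) (hG : 0 < G) (hM : 0 < M)
    (hs : ∀ j, 0 < Function.invFunOn (f j) (Ici 0) t)
    (hc : c ≤ (2 ^ (2 * N) * (2 ^ (q + 1) * G * M))⁻¹) :
    c * t ^ (-(q : ℤ)) * inverseProduct d f t * (2 ^ (q + 1) * G * M * t ^ q * (t ^ (2 * N))⁻¹ *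
      ∏ j, (Function.invFunOn (f j) (Ici 0) t) ^ d j) ≤ ((2 * t) ^ (2 * N))⁻¹ := by
  have hP : 0 < ∏ j, (Function.invFunOn (f j) (Ici 0) t) ^ d j :=
    Finset.prod_pos fun j _ => pow_pos (hs j) _
  have hinv : inverseProduct d f t = (∏ j, (Function.invFunOn (f j) (Ici 0) t) ^ d j)⁻¹ := by
    simp [inverseProduct]
  rw [hinv, zpow_neg, zpow_natCast]
  set P := ∏ j, (Function.invFunOn (f j) (Ici 0) t) ^ d j
  calc c * (t ^ q)⁻¹ * P⁻¹ * (2 ^ (q + 1) * G * M * t ^ q * (t ^ (2 * N))⁻¹ * P)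
      = c * (2 ^ (q + 1) * G * M) * (t ^ (2 * N))⁻¹ := by field_simp
    _ ≤ (2 ^ (2 * N) * (2 ^ (q + 1) * G * M))⁻¹ * (2 ^ (q + 1) * G * M) * (t ^ (2 * N))⁻¹ := by
        gcongr
    _ = ((2 * t) ^ (2 * N))⁻¹ := by
        rw [mul_pow]
        field_simp

end Main

/-- Both kernels on the diagonal enter through their extremal characterization, which is an
unconditional definition, and also through the reproducing kernel itself. -/
theorem theorem1p6 {m k : ℕ} (D : Set (EuclideanSpace ℂ (Fin (m + 1))))
    (hDopen : IsOpen D) (hDconn : IsConnected D) (hDbdd : Bornology.IsBounded D)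
    (hDC2 : HasC2Boundary D) (hD0 : (0 : EuclideanSpace ℂ (Fin (m + 1))) ∈ frontier D)
    (d : Fin k → ℕ) (e : (Σ j : Fin k, Fin (d j)) ≃ Fin m ⊕ Fin m) (f : Fin k → ℝ → ℝ) (δ : ℝ)
    (hD : IsExtendedDecoupledNearZero D e f δ) :
    ∃ C : ℝ, 0 < C ∧ ∀ z ∈ D, ‖z (Fin.last m)‖ < δ / 2 →
      (∀ j, (z (Fin.last m)).re ∈ f j '' Ici 0) →
      (ENNReal.ofReal (C * (z (Fin.last m)).re ^ (-2 : ℤ) *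
          inverseProduct d f (z (Fin.last m)).re) ≤ bergmanDiag D z ∧
        ∀ K, IsBergmanKernel D K →
          C * (z (Fin.last m)).re ^ (-2 : ℤ) * inverseProduct d f (z (Fin.last m)).re
            ≤ (K z z).re) ∧
      (ENNReal.ofReal (C * (z (Fin.last m)).re ^ (-1 : ℤ) *
          inverseProduct d f (z (Fin.last m)).re) ≤ szegoDiag D z ∧
        ∀ S, IsSzegoKernel D S →
          C * (z (Fin.last m)).re ^ (-1 : ℤ) * inverseProduct d f (z (Fin.last m)).re
            ≤ (S z z).re) := by
  have hne : (frontier D).Nonempty := ⟨0, hD0⟩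
  obtain ⟨A, s₀, hA, hs₀, hf⟩ := exists_common_growth hD.type_at_zero
  obtain ⟨R₀, hR, hDR⟩ := hDbdd.subset_closedBall_lt 0 0
  obtain ⟨M₁, hM₁, hvol⟩ := exists_volume_shell_le hD hf hA hs₀ hR.le hDR
  obtain ⟨ε₀, hε₀, M₂, hM₂, hsurf⟩ :=
    exists_surface_shell_le hD hDopen hDC2 hne hf hA hs₀ hR hDR
  set G := A ^ (∑ j, d j) with hG
  have hG0 : 0 < G := by positivity
  set M := M₁ + M₂ + 1 with hM
  have hM0 : 0 < M := by positivity
  -- N depends only on G, hence not on z; the condition for q = 2 implies that for q = 1.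
  obtain ⟨N, hN⟩ := pow_unbounded_of_one_lt (2 * (2 ^ 2 * G)) (show (1 : ℝ) < 4 by norm_num)
  have hN1 : 2 * (2 ^ 1 * G) ≤ 4 ^ N := by linarith
  refine ⟨(2 ^ (2 * N) * (2 ^ (2 + 1) * G * M))⁻¹, by positivity, fun z hz hzδ hrange => ?_⟩
  set ζ : ℂ := star (z (Fin.last m)) with hζ
  have hζre : ζ.re = (z (Fin.last m)).re := Complex.conj_re _
  have hζnorm : ‖ζ‖ < δ / 2 := by rwa [hζ, norm_star]
  have htz := norm_testFun_conj_sq (N := N) z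
  rw [← hζ] at htz
  rw [← hζre] at hrange htz ⊢
  have ht : 0 < ζ.re := by rw [hζre]; exact hD.subset_half z hz
  have hs := isInverseSystem_invFunOn hf ht hζnorm hrange
  set s : Fin k → ℝ := fun j => Function.invFunOn (f j) (Ici 0) ζ.re with hs_def
  have hP0 : 0 < ∏ j, s j ^ d j := Finset.prod_pos fun j _ => pow_pos (hs.pos j) _
  have hφ : Measurable fun w : EuclideanSpace ℂ (Fin (m + 1)) => ‖w (Fin.last m) + ζ‖ :=
    (((PiLp.continuous_apply 2 _ _).add continuous_const).norm).measurable
  have hdiff : DifferentiableOn ℂ (testFun ζ N) D := fun w hw =>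
    (differentiableAt_testFun
      (re_pos_of_mem_closure hD ht (subset_closure hw)).2).differentiableWithinAt
  have hint : ∀ (q : ℕ) (μ : Measure (EuclideanSpace ℂ (Fin (m + 1)))),
      2 * (2 ^ q * G) ≤ 4 ^ N → (∀ᵐ w ∂μ, w ∈ closure D) →
      (∀ i : ℕ, μ {w | ‖w (Fin.last m) + ζ‖ < 2 ^ i * ζ.re} ≤
        ENNReal.ofReal (M * (2 ^ i * ζ.re) ^ q * (G ^ i * ∏ j, s j ^ d j))) →
      ∫⁻ w, ‖testFun ζ N w‖ₑ ^ 2 ∂μ ≤ ENNReal.ofReal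
        (2 ^ (q + 1) * G * M * ζ.re ^ q * (ζ.re ^ (2 * N))⁻¹ * ∏ j, s j ^ d j) := by
    intro q μ hq hμD hμ
    simp_rw [enorm_testFun_sq]
    exact lintegral_inv_pow_le hφ ht hM0.le hG0.le hP0.le hq
      (hμD.mono fun w hw => (re_pos_of_mem_closure hD ht hw).1) hμ
  set Q : ℕ → ℝ := fun q => 2 ^ (q + 1) * G * M * ζ.re ^ q * (ζ.re ^ (2 * N))⁻¹ * ∏ j, s j ^ d j
    with hQ
  have hQ0 : ∀ q, 0 < Q q := fun q => by positivity
  have hberg : ∫⁻ w in D, ‖testFun ζ N w‖ₑ ^ 2 ≤ ENNReal.ofReal (Q 2) := by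
    refine hint 2 _ hN.le ?_ fun i => ?_
    · filter_upwards [ae_restrict_mem hDopen.measurableSet] with w hw using subset_closure hw
    · rw [Measure.restrict_apply (measurableSet_lt hφ measurable_const), inter_comm]
      refine (hvol ζ s hs i).trans (ENNReal.ofReal_le_ofReal ?_)
      gcongr
      linarith
  have hsz : ∀ ε, 0 ≤ ε → ε < ε₀ → ∫⁻ w, ‖testFun ζ N w‖ₑ ^ 2
      ∂surfaceMeasure (frontier (innerDomain D ε)) ≤ ENNReal.ofReal (Q 1) := by
    intro ε hε hε'
    refine hint 1 _ hN1 ?_ fun i => ?_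
    · filter_upwards [ae_restrict_mem isClosed_frontier.measurableSet] with w hw
      exact frontier_innerDomain_subset D ε hw
    · refine (hsurf ε hε hε' ζ s hs i).trans (ENNReal.ofReal_le_ofReal ?_)
      gcongr
      linarith
  have hev : ∀ᶠ ε in 𝓝[>] (0 : ℝ), ∫⁻ w, ‖testFun ζ N w‖ₑ ^ 2
      ∂surfaceMeasure (frontier (innerDomain D ε)) ≤ ENNReal.ofReal (Q 1) := by
    filter_upwards [Ioo_mem_nhdsGT hε₀] with ε hε using hsz ε hε.1.le hε.2
  have hmemB : MemBergman D (testFun ζ N) := by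
    refine ⟨hdiff, measurable_testFun.aestronglyMeasurable, ?_⟩
    rw [eLpNorm_lt_top_iff_lintegral_rpow_enorm_lt_top two_ne_zero ENNReal.ofNat_ne_top]
    simpa using hberg.trans_lt ENNReal.ofReal_lt_top
  have hmemH : MemHardy D (testFun ζ N) :=
    ⟨hdiff, (hardyNormSq_le hev).trans_lt ENNReal.ofReal_lt_top⟩
  have hcB : (2 ^ (2 * N) * (2 ^ (2 + 1) * G * M))⁻¹ * ζ.re ^ (-2 : ℤ) *
      inverseProduct d f ζ.re * Q 2 ≤ ‖testFun ζ N z‖ ^ 2 := by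
    rw [htz]
    exact mul_inverseProduct_mul_le (q := 2) ht hG0 hM0 hs.pos le_rfl
  have hcS : (2 ^ (2 * N) * (2 ^ (2 + 1) * G * M))⁻¹ * ζ.re ^ (-1 : ℤ) *
      inverseProduct d f ζ.re * Q 1 ≤ ‖testFun ζ N z‖ ^ 2 := by
    rw [htz]
    refine mul_inverseProduct_mul_le (q := 1) ht hG0 hM0 hs.pos ?_
    gcongr <;> norm_num
  refine ⟨⟨ofReal_le_bergmanDiag hmemB (hQ0 2) hberg hcB, fun K hK => ?_⟩,
    ⟨ofReal_le_szegoDiag hdiff (hQ0 1) hev hcS, fun S hS => ?_⟩⟩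
  · have := hcB.trans (sq_norm_le_of_isBergmanKernel hDopen hK hz hmemB (hQ0 2).le hberg)
    rw [mul_comm (Q 2)] at this
    exact le_of_mul_le_mul_right this (hQ0 2)
  -- The case ε = 0 is the integral over bD itself, which the reproducing formula needs in place of
  -- the Hardy norm.
  · have hsz0 := hsz 0 le_rfl hε₀
    rw [innerDomain_zero hDopen hne] at hsz0
    have := hcS.trans (sq_norm_le_of_isSzegoKernel hS hz hmemH (isBoundaryValue_testFun hD ht N)
      measurable_testFun.aestronglyMeasurable (hQ0 1).le hsz0)
    rw [mul_comm (Q 1)] at this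
    exact le_of_mul_le_mul_right this (hQ0 1)
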